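/- Let $K$ be a field, $n\ge 0$, $S=K[X_1,\dots,X_n]$ and $\mathfrak m=(X_1,\dots,X_n)$. For an ideal $I\subset S$ put $R=S/I$ and let $H^i_{\mathfrak m}(R)$ be the $i$-th local cohomology module of the $S$-module $R$ with support in $\mathfrak m$. Call $I$ *generalized Cohen–Macaulay* if $H^i_{\mathfrak m}(R)$ has finite length for all $i\ne\dim R$. For $k\in\mathbb Z$ call $R$ *$k$-Buchsbaum* if $\mathfrak m^kH^i_{\mathfrak m}(R)=0$ for all $i\neq\dim R$, where $\mathfrak m^k:=S$ if $k\le 0$; call it *strictly $k$-Buchsbaum* if it is $k$-Buchsbaum but not $(k-1)$-Buchsbaum. For a monomial ideal $I$ let $G(I)$ be its minimal set of monomial generators and let $\rho_j$ be the largest exponent of $X_j$ occurring in an element of $G(I)$ (with $\rho_j=0$ if $I=0$). **Theorem.** (1) If $I\subset S$ is a generalized Cohen–Macaulay monomial ideal, then $R=S/I$ is $\left(\sum_{j=1}^n\rho_j-n+1\right)$-Buchsbaum, that is, $\mathfrak m^kH^i_{\mathfrak m}(R)=0$ for all $i\ne\dim R$, with $k=\sum_{j=1}^n\rho_j-n+1$.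 (2) The bound is sharp: for every field $K$ and every integer $k\ge1$ there are an $n$ and a generalized Cohen–Macaulay monomial ideal $I\subset K[X_1,\dots,X_n]$ with $\sum_{j=1}^n\rho_j-n+1=k$ such that $S/I$ is strictly $k$-Buchsbaum. -/

import Mathlib

noncomputable section

namespace MonomialLC

open MvPolynomial

/-- An ideal of `K[X_1, …, X_n]` is a monomial ideal if it is generated by a set of monomials. -/
def IsMonomialIdeal {K : Type*} [Field K] {n : ℕ} (I : Ideal (MvPolynomial (Fin n) K)) : Prop :=
  ∃ s : Set (Fin n →₀ ℕ), I = Ideal.span ((fun a => (monomial a (1 : K))) '' s)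

/-- The (exponent vectors of the) minimal monomial generators `G(I)` of a monomial ideal:
the monomials of `I` that are minimal with respect to divisibility. -/
def minGens {K : Type*} [Field K] {n : ℕ} (I : Ideal (MvPolynomial (Fin n) K)) :
    Set (Fin n →₀ ℕ) :=
  {a | Minimal (fun b => monomial b (1 : K) ∈ I) a}

/-- There are only finitely many minimal generators, so the supremum in `rho` is a maximum
(whenever `I ≠ 0`). -/
theorem minGens_finite {K : Type*} [Field K] {n : ℕ} (I : Ideal (MvPolynomial (Fin n) K)) :
    (minGens I).Finite := by
  have h : IsAntichain (· ≤ ·) (minGens I) := by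
    intro a ha b hb hab hle
    exact hab (le_antisymm hle (hb.2 ha.1 hle))
  exact h.finite_of_partiallyWellOrderedOn (Set.isPWO_of_wellQuasiOrderedLE _)

/-- `ρ_j`, the largest exponent of `X_j` in a minimal monomial generator of `I`;
it is `0` when there is no generator, that is, for `I = 0`. -/
def rho {K : Type*} [Field K] {n : ℕ} (I : Ideal (MvPolynomial (Fin n) K)) (j : Fin n) : ℕ :=
  sSup ((fun a : Fin n →₀ ℕ => a j) '' minGens I)

/-- The graded maximal ideal `(X_1, …, X_n)` of `S = K[X_1, …, X_n]`. -/
def maxIdeal (K : Type*) [Field K] (n : ℕ) : Ideal (MvPolynomial (Fin n) K) :=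
  Ideal.span (Set.range X)

universe u

/-- The local cohomology module `H^i_𝔪(S/I)`, as a module over `S = K[X_1, …, X_n]`. -/
abbrev H {K : Type u} [Field K] {n : ℕ} (I : Ideal (MvPolynomial (Fin n) K)) (i : ℕ) :
    ModuleCat.{u} (MvPolynomial (Fin n) K) :=
  (localCohomology (maxIdeal K n) i).obj
    (ModuleCat.of (MvPolynomial (Fin n) K) (MvPolynomial (Fin n) K ⧸ I))

/-- `S/I` is generalized Cohen–Macaulay: `H^i_𝔪(S/I)` has finite length for `i ≠ dim S/I`. -/
def IsGeneralizedCM {K : Type u} [Field K] {n : ℕ} (I : Ideal (MvPolynomial (Fin n) K)) : Prop :=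
  ∀ i : ℕ, (i : WithBot ℕ∞) ≠ ringKrullDim (MvPolynomial (Fin n) K ⧸ I) →
    IsFiniteLength (MvPolynomial (Fin n) K) (H I i)

/-- `S/I` is `k`-Buchsbaum: `𝔪^k H^i_𝔪(S/I) = 0` for all `i ≠ dim S/I`.
For a negative integer `k`, the power `𝔪^k` is read as the unit ideal, as for `k = 0`. -/
def IsBuchsbaum {K : Type u} [Field K] {n : ℕ} (k : ℤ)
    (I : Ideal (MvPolynomial (Fin n) K)) : Prop :=
  ∀ i : ℕ, (i : WithBot ℕ∞) ≠ ringKrullDim (MvPolynomial (Fin n) K ⧸ I) →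
    (maxIdeal K n) ^ k.toNat • (⊤ : Submodule (MvPolynomial (Fin n) K) (H I i)) = ⊥

/-- `k`-Buchsbaum but not `(k-1)`-Buchsbaum. -/
def IsStrictlyBuchsbaum {K : Type u} [Field K] {n : ℕ} (k : ℤ)
    (I : Ideal (MvPolynomial (Fin n) K)) : Prop :=
  IsBuchsbaum k I ∧ ¬ IsBuchsbaum (k - 1) I

end MonomialLC

end

/-! Bound. Fix $j$, put $r = X_j^{\rho_j}$ and $J = I : r$. No minimal generator has $X_j$-exponent
above $\rho_j$, so $J$ is generated by monomials in the other variables. Division by $X_j$ is then a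
left inverse of multiplication by $X_j$ on $S/J$, linear over the other variables, and this makes
$H^i_{\mathfrak m}(S/J)$ divisible by $X_j$ (`localCohomology_X_divisible`). Multiplication by $r$
factors as $S/I \to S/J \to S/I$, and the opposite composite is $r$ on $S/J$. If $X_j^N$ kills
$H^i_{\mathfrak m}(S/I)$, as finite length guarantees, then every $y = X_j^N r y''$ in
$H^i_{\mathfrak m}(S/J)$ is zero; so $r$ acts on $H^i_{\mathfrak m}(S/I)$ through a zero module
(`IsMonomialIdeal.X_pow_rho_smul_eq_zero`). A monomial of degree $\sum\rho_j - n + 1$ has some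
exponent at least $\rho_j$, hence acts as zero.

Sharpness. For $I = (X_0^k, X_1) \cap (X_2, X_3)$ the sequence $0 \to S/I \to S/b \times S/c \to
S/(b+c) \to 0$ makes $H^1_{\mathfrak m}(S/I)$ cyclic with annihilator $(X_0^k, X_1, X_2, X_3)$. It
is the only nonzero local cohomology module outside degree $2 = \dim S/I$, and $X_0^{k-1}$ does not
kill it.

Method. Local cohomology is the colimit of $\mathrm{Ext}^i(R/a_t, M)$ over any sequence $a_t$
cofinal with the powers of the ideal. Arguments are made on Ext classes at a finite stage; the
stages $(X_1^t, \dots, X_n^t)$ are built one variable at a time. -/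

namespace MonomialLC
open CategoryTheory Limits Opposite Abelian
noncomputable section
universe v

/-! ### Comparison of derived-functor Ext with derived-category Ext -/

section ExtComparison

set_option linter.unusedSectionVars false

variable {R : Type v} [CommRing R] {C : Type*} [Category.{v} C] [Abelian C] [Linear R C]
  [EnoughProjectives C]

variable (R) in
/-- The complex `Hom(P, Y)` in the opposite category. -/
abbrev homComplex {X : C} (P : ProjectiveResolution X) (Y : C) :
    ChainComplex (ModuleCat.{v} R)ᵒᵖ ℕ :=
  (((linearYoneda R C).obj Y).rightOp.mapHomologicalComplex _).obj P.complex

variable (R) in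
/-- An element of a module as a morphism to `R` in the opposite category. -/
def elemOp {M : ModuleCat.{v} R} (x : M) : op M ⟶ op (ModuleCat.of R R) :=
  (ModuleCat.ofHom (LinearMap.toSpanSingleton R M x)).op

/-- Morphisms into `op R` are elements of modules, and injectivity lets them extend along
monomorphisms: this is how classes lift to cocycles below. -/
instance : Injective (op (ModuleCat.of R R)) := by
  have : Projective (ModuleCat.of R R) :=
    (IsProjective.iff_projective (R := R) R).mp inferInstance
  infer_instance

lemma elemOp_surjective {M : ModuleCat.{v} R} (f : op M ⟶ op (ModuleCat.of R R)) :
    ∃ x : M, f = elemOp R x := by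
  refine ⟨f.unop.hom 1, ?_⟩
  apply Quiver.Hom.unop_inj
  ext
  simp [elemOp]

lemma elemOp_injective {M : ModuleCat.{v} R} {x y : M} (h : elemOp R x = elemOp R y) : x = y := by
  have := congrArg (fun f => f.unop.hom 1) h
  simpa [elemOp] using this

lemma comp_elemOp {M N : ModuleCat.{v} R} (g : M ⟶ N) (x : M) :
    g.op ≫ elemOp R x = elemOp R (g.hom x) := by
  apply Quiver.Hom.unop_inj
  ext
  simp [elemOp]

lemma elemOp_zero {M : ModuleCat.{v} R} : elemOp R (0 : M) = 0 := by
  apply Quiver.Hom.unop_inj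
  ext
  simp [elemOp]

lemma elemOp_add {M : ModuleCat.{v} R} (x y : M) : elemOp R (x + y) = elemOp R x + elemOp R y := by
  apply Quiver.Hom.unop_inj
  ext
  simp [elemOp]

lemma elemOp_smul {M : ModuleCat.{v} R} (r : R) (x : M) :
    elemOp R (r • x) = elemOp R x ≫ (ModuleCat.ofHom (r • LinearMap.id)).op := by
  apply Quiver.Hom.unop_inj
  ext
  simp [elemOp]

variable (R) in
/-- The underlying module of the derived-functor `Ext`. -/
abbrev OldExt (X Y : C) (n : ℕ) : ModuleCat.{v} R := ((_root_.Ext R C n).obj (op X)).obj Y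

variable (R) in
/-- The derived-functor `Ext` computed by a projective resolution. -/
def oldExtIso {X : C} (P : ProjectiveResolution X) (Y : C) (n : ℕ) :
    op (OldExt R X Y n) ≅ (homComplex R P Y).homology n :=
  P.isoLeftDerivedObj ((linearYoneda R C).obj Y).rightOp n

variable (R) in
/-- A cochain `f : P_n ⟶ Y` as a morphism to `R` in the opposite category. -/
def cochainOp {X : C} (P : ProjectiveResolution X) {Y : C} {n : ℕ} (f : P.complex.X n ⟶ Y) :
    (homComplex R P Y).X n ⟶ op (ModuleCat.of R R) :=
  elemOp R (M := ModuleCat.of R (P.complex.X n ⟶ Y)) f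

variable (R) in
/-- The cocycle `f` represents the class `e`. -/
def Represents {X : C} (P : ProjectiveResolution X) {Y : C} {n : ℕ} (f : P.complex.X n ⟶ Y)
    (e : OldExt R X Y n) : Prop :=
  ∃ c : (homComplex R P Y).opcycles n ⟶ op (ModuleCat.of R R),
    (homComplex R P Y).pOpcycles n ≫ c = cochainOp R P f ∧
    (oldExtIso R P Y n).hom ≫ (homComplex R P Y).homologyι n ≫ c = elemOp R e

lemma cochainOp_surjective {X : C} (P : ProjectiveResolution X) {Y : C} {n : ℕ}
    (g : (homComplex R P Y).X n ⟶ op (ModuleCat.of R R)) :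
    ∃ f : P.complex.X n ⟶ Y, g = cochainOp R P f :=
  elemOp_surjective (M := ModuleCat.of R (P.complex.X n ⟶ Y)) g

lemma cochainOp_injective {X : C} {P : ProjectiveResolution X} {Y : C} {n : ℕ}
    {f g : P.complex.X n ⟶ Y} (h : cochainOp R P f = cochainOp R P g) : f = g :=
  elemOp_injective (M := ModuleCat.of R (P.complex.X n ⟶ Y)) h

lemma cochainOp_zero {X : C} (P : ProjectiveResolution X) {Y : C} {n : ℕ} :
    cochainOp R P (0 : P.complex.X n ⟶ Y) = 0 :=
  elemOp_zero (M := ModuleCat.of R (P.complex.X n ⟶ Y))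

lemma cochainOp_add {X : C} (P : ProjectiveResolution X) {Y : C} {n : ℕ}
    (f g : P.complex.X n ⟶ Y) :
    cochainOp R P (f + g) = cochainOp R P f + cochainOp R P g :=
  elemOp_add (M := ModuleCat.of R (P.complex.X n ⟶ Y)) f g

lemma cochainOp_smul {X : C} (P : ProjectiveResolution X) {Y : C} {n : ℕ}
    (r : R) (f : P.complex.X n ⟶ Y) :
    cochainOp R P (r • f) = cochainOp R P f ≫ (ModuleCat.ofHom (r • LinearMap.id)).op :=
  elemOp_smul (M := ModuleCat.of R (P.complex.X n ⟶ Y)) r f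

lemma homComplex_d_comp_elemOp {X : C} (P : ProjectiveResolution X) {Y : C} {n : ℕ} (m : ℕ)
    (f : P.complex.X n ⟶ Y) :
    (homComplex R P Y).d m n ≫ cochainOp R P f =
      cochainOp R P (P.complex.d m n ≫ f) :=
  comp_elemOp (R := R) (((linearYoneda R C).obj Y).map (P.complex.d m n).op) f

lemma exists_represents {X : C} (P : ProjectiveResolution X) {Y : C} {n : ℕ}
    (f : P.complex.X n ⟶ Y) (hf : P.complex.d (n + 1) n ≫ f = 0) :
    ∃ e : OldExt R X Y n, Represents R P f e := by
  have hc : (homComplex R P Y).d (n + 1) n ≫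
      cochainOp R P f = 0 := by
    rw [homComplex_d_comp_elemOp, hf, cochainOp_zero]
  obtain ⟨e, he⟩ := elemOp_surjective (R := R) (M := OldExt R X Y n)
    ((oldExtIso R P Y n).hom ≫
      (homComplex R P Y).homologyι n ≫ (homComplex R P Y).descOpcycles _ (n + 1) (by simp) hc)
  exact ⟨e, _, HomologicalComplex.p_descOpcycles _ _ _ _ _, he⟩

lemma represents_surjective {X : C} (P : ProjectiveResolution X) {Y : C} {n : ℕ}
    (e : OldExt R X Y n) : ∃ f : P.complex.X n ⟶ Y, P.complex.d (n + 1) n ≫ f = 0 ∧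
      Represents R P f e := by
  let i := (oldExtIso R P Y n).hom ≫
      (homComplex R P Y).homologyι n
  -- In the opposite category homology is a subobject of the opcycles, so an extension of `e` along
  -- it is a cocycle representing `e`.
  let c : (homComplex R P Y).opcycles n ⟶ op (ModuleCat.of R R) :=
    Injective.factorThru (elemOp R (M := OldExt R X Y n) e) i
  have hc : i ≫ c = elemOp R (M := OldExt R X Y n) e := Injective.comp_factorThru _ _
  obtain ⟨f, hf⟩ := cochainOp_surjective (R := R) P (Y := Y)
    ((homComplex R P Y).pOpcycles n ≫ c)
  refine ⟨f, ?_, c, hf, by simpa [i] using hc⟩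
  refine cochainOp_injective (R := R) ?_
  rw [← homComplex_d_comp_elemOp, ← hf, HomologicalComplex.d_pOpcycles_assoc, zero_comp, cochainOp_zero]

lemma Represents.unique {X : C} {P : ProjectiveResolution X} {Y : C} {n : ℕ}
    {f : P.complex.X n ⟶ Y} {e e' : OldExt R X Y n} (h : Represents R P f e)
    (h' : Represents R P f e') : e = e' := by
  obtain ⟨c, hc, hce⟩ := h
  obtain ⟨c', hc', hce'⟩ := h'
  obtain rfl : c = c' := by
    rw [← cancel_epi ((homComplex R P Y).pOpcycles n), hc, hc']
  exact elemOp_injective (hce.symm.trans hce')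

/-- A functional on opcycles vanishing on homology factors through the differential, again because
`op R` is injective. -/
lemma Represents.eq_boundary {X : C} {P : ProjectiveResolution X} {Y : C} {n : ℕ}
    {f : P.complex.X n ⟶ Y} (h : Represents R P f (0 : OldExt R X Y n)) :
     (n = 0 ∧ f = 0) ∨ ∃ m, m + 1 = n ∧ ∃ g : P.complex.X m ⟶ Y, P.complex.d n m ≫ g = f := by
  obtain ⟨c, hc, hce⟩ := h
  rw [elemOp_zero, Preadditive.IsIso.comp_left_eq_zero] at hce
  have hex : (ShortComplex.mk _ _ ((homComplex R P Y).homologyι_comp_fromOpcycles n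
      ((ComplexShape.down ℕ).next n))).Exact :=
    ShortComplex.exact_of_f_is_kernel _ ((homComplex R P Y).homologyIsKernel n _ rfl)
  have hg := hex.comp_descToInjective c hce
  obtain ⟨g, hg'⟩ := cochainOp_surjective (R := R) P (Y := Y)
    (hex.descToInjective c hce)
  have key : P.complex.d n ((ComplexShape.down ℕ).next n) ≫ g = f := by
    refine cochainOp_injective (R := R) ?_
    rw [← homComplex_d_comp_elemOp, ← hg', ← hc, ← HomologicalComplex.p_fromOpcycles_assoc]
    exact congrArg _ hg
  -- In degree 0 the successor index is 0 itself and that differential is zero, which forces `f =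
  -- 0`.
  rcases n with _ | n
  · left
    refine ⟨rfl, ?_⟩
    rw [← key, P.complex.shape _ _ (by simp), zero_comp]
  · right
    have : (ComplexShape.down ℕ).next (n + 1) = n := ChainComplex.next_nat_succ n
    clear hg' hg hex
    generalize (ComplexShape.down ℕ).next (n + 1) = k at this g key
    subst this
    exact ⟨k, rfl, g, key⟩

lemma represents_boundary {X : C} {P : ProjectiveResolution X} {Y : C} {n m : ℕ}
    (g : P.complex.X m ⟶ Y) : Represents R P (P.complex.d n m ≫ g) (0 : OldExt R X Y n) := by
  refine ⟨(homComplex R P Y).fromOpcycles n m ≫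
    cochainOp R P g, ?_, ?_⟩
  · rw [HomologicalComplex.p_fromOpcycles_assoc, homComplex_d_comp_elemOp]
  · rw [elemOp_zero, HomologicalComplex.homologyι_comp_fromOpcycles_assoc, zero_comp, comp_zero]

lemma Represents.add {X : C} {P : ProjectiveResolution X} {Y : C} {n : ℕ}
    {f f' : P.complex.X n ⟶ Y} {e e' : OldExt R X Y n} (h : Represents R P f e)
    (h' : Represents R P f' e') : Represents R P (f + f') (e + e') := by
  obtain ⟨c, hc, hce⟩ := h
  obtain ⟨c', hc', hce'⟩ := h'
  refine ⟨c + c', ?_, ?_⟩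
  · rw [Preadditive.comp_add, hc, hc']
    exact (cochainOp_add P f f').symm
  · rw [Preadditive.comp_add, Preadditive.comp_add, hce, hce', elemOp_add]

lemma Represents.smul {X : C} {P : ProjectiveResolution X} {Y : C} {n : ℕ}
    {f : P.complex.X n ⟶ Y} {e : OldExt R X Y n} (h : Represents R P f e) (r : R) :
    Represents R P (r • f) (r • e) := by
  obtain ⟨c, hc, hce⟩ := h
  refine ⟨c ≫ (ModuleCat.ofHom (r • LinearMap.id)).op, ?_, ?_⟩
  · rw [reassoc_of% hc]
    exact (cochainOp_smul P r f).symm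
  · rw [reassoc_of% hce, elemOp_smul]

lemma Represents.postcomp {X : C} {P : ProjectiveResolution X} {Y Y' : C} {n : ℕ}
    {f : P.complex.X n ⟶ Y} {e : OldExt R X Y n} (h : Represents R P f e) (g : Y ⟶ Y') :
    Represents R P (f ≫ g) ((((_root_.Ext R C n).obj (op X)).map g).hom e) := by
  obtain ⟨c, hc, hce⟩ := h
  let α : ((linearYoneda R C).obj Y').rightOp ⟶ ((linearYoneda R C).obj Y).rightOp :=
    NatTrans.rightOp ((linearYoneda R C).map g)
  let K : homComplex R P Y' ⟶ homComplex R P Y :=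
    (NatTrans.mapHomologicalComplex α (ComplexShape.down ℕ)).app P.complex
  have hK : (((_root_.Ext R C n).obj (op X)).map g).op ≫ (oldExtIso R P Y n).hom =
      (oldExtIso R P Y' n).hom ≫ HomologicalComplex.homologyMap K n := by
    have := P.leftDerived_app_eq α n
    rw [← Category.assoc _ _ (P.isoLeftDerivedObj _ n).inv, Iso.eq_comp_inv] at this
    exact this
  refine ⟨HomologicalComplex.opcyclesMap K n ≫ c, ?_, ?_⟩
  · rw [HomologicalComplex.p_opcyclesMap_assoc, hc]
    exact comp_elemOp (R := R) (((linearYoneda R C).map g).app (op (P.complex.X n))) f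
  · rw [← HomologicalComplex.homologyι_naturality_assoc, ← reassoc_of% hK, hce, comp_elemOp]

lemma Represents.precomp {X X' : C} {P : ProjectiveResolution X} {P' : ProjectiveResolution X'}
    {Y : C} {n : ℕ} {f : P.complex.X n ⟶ Y} {e : OldExt R X Y n} (h : Represents R P f e)
    {g : X' ⟶ X} (φ : ProjectiveResolution.Hom P' P g) :
    Represents R P' (φ.hom.f n ≫ f) ((((_root_.Ext R C n).map g.op).app Y).hom e) := by
  obtain ⟨c, hc, hce⟩ := h
  let K : homComplex R P' Y ⟶ homComplex R P Y :=
    (((linearYoneda R C).obj Y).rightOp.mapHomologicalComplex _).map φ.hom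
  have hK : (((_root_.Ext R C n).map g.op).app Y).op ≫ (oldExtIso R P Y n).hom =
      (oldExtIso R P' Y n).hom ≫ HomologicalComplex.homologyMap K n :=
    ProjectiveResolution.isoLeftDerivedObj_hom_naturality g P' P φ.hom
      (by rw [φ.hom_f_zero_comp_π_f_zero, ChainComplex.single₀_map_f_zero]; rfl)
      ((linearYoneda R C).obj Y).rightOp n
  refine ⟨HomologicalComplex.opcyclesMap K n ≫ c, ?_, ?_⟩
  · rw [HomologicalComplex.p_opcyclesMap_assoc, hc]
    exact comp_elemOp (R := R) (((linearYoneda R C).obj Y).map (φ.hom.f n).op) f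
  · rw [← HomologicalComplex.homologyι_naturality_assoc, ← reassoc_of% hK, hce, comp_elemOp]

variable [HasExt.{v} C]

lemma smul_extMk {X : C} (P : ProjectiveResolution X) {Y : C} {n : ℕ} (r : R)
    (f : P.complex.X n ⟶ Y) (hf : P.complex.d (n + 1) n ≫ f = 0) :
    r • P.extMk f (n + 1) rfl hf = P.extMk (r • f) (n + 1) rfl (by simp [hf]) := by
  rw [Abelian.Ext.smul_eq_comp_mk₀, ProjectiveResolution.extMk_comp_mk₀]
  congr 1
  simp

omit [EnoughProjectives C] in
-- Degree 0 has no coboundaries, as the resolution has nothing in negative degree;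
-- `extMk_eq_zero_iff` needs a preceding degree and does not cover this case.
lemma extMk_eq_zero_of_degree_zero {X : C} (P : ProjectiveResolution X) {Y : C}
    (f : P.complex.X 0 ⟶ Y) (hf : P.complex.d 1 0 ≫ f = 0)
    (h : P.extMk f 1 rfl hf = 0) : f = 0 := by
  rw [← P.extEquivCohomologyClass.apply_eq_iff_eq,
    ProjectiveResolution.extEquivCohomologyClass_extMk,
    ProjectiveResolution.extEquivCohomologyClass_zero,
    CochainComplex.HomComplex.CohomologyClass.mk_eq_zero_iff,
    CochainComplex.HomComplex.Cocycle.toSingleMk_mem_coboundaries_iff _ _ _ _ _ 1 (by simp)] at h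
  obtain ⟨g, hg⟩ := h
  have hz : IsZero (P.cochainComplex.X 1) := P.cochainComplex.isZero_of_isStrictlyLE 0 1 (by simp)
  rw [hz.eq_of_src g 0, comp_zero] at hg
  rw [← cancel_epi (P.cochainComplexXIso (-(0 : ℕ)) 0 rfl).hom, comp_zero]
  exact hg.symm

lemma represents_zero_iff {X : C} (P : ProjectiveResolution X) {Y : C} {n : ℕ}
    (f : P.complex.X n ⟶ Y) (hf : P.complex.d (n + 1) n ≫ f = 0) :
    Represents R P f (0 : OldExt R X Y n) ↔ P.extMk f (n + 1) rfl hf = 0 := by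
  constructor
  · intro h
    rcases h.eq_boundary with ⟨-, rfl⟩ | ⟨m, hm, hg⟩
    · simp
    · exact (P.extMk_eq_zero_iff f (n + 1) rfl hf m hm).mpr hg
  · intro h
    rcases n with _ | n
    · obtain rfl := extMk_eq_zero_of_degree_zero P f hf h
      refine ⟨0, ?_, ?_⟩
      · rw [comp_zero, cochainOp_zero]
      · rw [comp_zero, comp_zero, elemOp_zero]
    · obtain ⟨g, rfl⟩ := (P.extMk_eq_zero_iff f (n + 1 + 1) rfl hf n rfl).mp h
      exact represents_boundary g

/-- Two cocycles of the same class differ by one representing zero on both sides, so the comparison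
does not depend on the chosen cocycle. -/
lemma existsUnique_represents {X : C} (P : ProjectiveResolution X) {Y : C} {n : ℕ}
    (z : Abelian.Ext X Y n) : ∃ e : OldExt R X Y n,
      ∀ (f : P.complex.X n ⟶ Y) (hf : P.complex.d (n + 1) n ≫ f = 0),
        P.extMk f (n + 1) rfl hf = z → Represents R P f e := by
  obtain ⟨f, hf, rfl⟩ := P.extMk_surjective z (n + 1) rfl
  obtain ⟨e, he⟩ := exists_represents (R := R) P f hf
  refine ⟨e, fun f' hf' h => ?_⟩
  have h0 : Represents R P (f' - f) (0 : OldExt R X Y n) := by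
    rw [represents_zero_iff P (f' - f) (by simp [hf, hf']), ← P.sub_extMk _ _ _ _ hf' hf, h, sub_self]
  simpa using h0.add he

variable (R) in
/-- The comparison map from `Ext` in the derived category to the derived functor `Ext`. -/
def compareExt (X Y : C) (n : ℕ) : Abelian.Ext X Y n →ₗ[R] OldExt R X Y n where
  toFun z := (existsUnique_represents (projectiveResolution X) z).choose
  map_add' z z' := by
    set P := projectiveResolution X
    have hs := fun z : Abelian.Ext X Y n => (existsUnique_represents (R := R) P z).choose_spec
    obtain ⟨f, hf, h⟩ := P.extMk_surjective z (n + 1) rfl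
    obtain ⟨f', hf', h'⟩ := P.extMk_surjective z' (n + 1) rfl
    refine Represents.unique (hs _ (f + f') (by simp [hf, hf']) ?_)
      ((hs z f hf h).add (hs z' f' hf' h'))
    rw [← P.add_extMk _ _ _ _ hf hf', h, h']
  map_smul' r z := by
    set P := projectiveResolution X
    have hs := fun z : Abelian.Ext X Y n => (existsUnique_represents (R := R) P z).choose_spec
    obtain ⟨f, hf, h⟩ := P.extMk_surjective z (n + 1) rfl
    refine Represents.unique (hs _ (r • f) (by simp [hf]) ?_) ((hs z f hf h).smul r)
    rw [← smul_extMk _ _ _ hf, h]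

lemma represents_compareExt {X Y : C} {n : ℕ} (f : (projectiveResolution X).complex.X n ⟶ Y)
    (hf : (projectiveResolution X).complex.d (n + 1) n ≫ f = 0) :
    Represents R _ f (compareExt R X Y n ((projectiveResolution X).extMk f (n + 1) rfl hf)) :=
  (existsUnique_represents (R := R) (projectiveResolution X) _).choose_spec f hf rfl

lemma compareExt_bijective (X Y : C) (n : ℕ) : Function.Bijective (compareExt R X Y n) := by
  constructor
  · rw [← LinearMap.ker_eq_bot, LinearMap.ker_eq_bot']
    intro z hz
    obtain ⟨f, hf, rfl⟩ := (projectiveResolution X).extMk_surjective z (n + 1) rfl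
    have := represents_compareExt (R := R) f hf
    rw [hz] at this
    exact (represents_zero_iff _ f hf).mp this
  · intro e
    obtain ⟨f, hf, h⟩ := represents_surjective (projectiveResolution X) e
    exact ⟨_, (represents_compareExt f hf).unique h⟩

lemma compareExt_comp_mk₀ {X Y Y' : C} {n : ℕ} (z : Abelian.Ext X Y n) (g : Y ⟶ Y') :
    compareExt R X Y' n (z.comp (Abelian.Ext.mk₀ g) (add_zero n)) =
      (((_root_.Ext R C n).obj (op X)).map g).hom (compareExt R X Y n z) := by
  obtain ⟨f, hf, rfl⟩ := (projectiveResolution X).extMk_surjective z (n + 1) rfl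
  rw [ProjectiveResolution.extMk_comp_mk₀]
  exact (represents_compareExt _ _).unique ((represents_compareExt f hf).postcomp g)

/-- Naturality in the first variable identifies the transition maps of the colimit defining local
cohomology with composition of Ext classes. -/
lemma compareExt_mk₀_comp {X X' Y : C} {n : ℕ} (z : Abelian.Ext X Y n) (g : X' ⟶ X) :
    compareExt R X' Y n ((Abelian.Ext.mk₀ g).comp z (zero_add n)) =
      (((_root_.Ext R C n).map g.op).app Y).hom (compareExt R X Y n z) := by
  obtain ⟨f, hf, rfl⟩ := (projectiveResolution X).extMk_surjective z (n + 1) rfl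
  let φ : ProjectiveResolution.Hom (projectiveResolution X') (projectiveResolution X) g :=
    { hom := ProjectiveResolution.lift g _ _
      hom_f_zero_comp_π_f_zero := by
        rw [ChainComplex.single₀_map_f_zero]
        exact ProjectiveResolution.lift_commutes_zero g _ _ }
  rw [ProjectiveResolution.mk₀_comp_extMk f _ rfl hf φ]
  exact (represents_compareExt _ _).unique ((represents_compareExt f hf).precomp φ)

end ExtComparison
end
end MonomialLC

namespace MonomialLC
open CategoryTheory Limits Opposite Abelian
noncomputable section
universe u

/-! ### Local cohomology as germs of Ext classes -/

section LocalCohomologyModel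

variable {R : Type u} [CommRing R]

/-- The quotient map `R ⧸ a → R ⧸ b` for `a ≤ b`. -/
def quotMap {a b : Ideal R} (h : a ≤ b) :
    ModuleCat.of R (R ⧸ a) ⟶ ModuleCat.of R (R ⧸ b) :=
  ModuleCat.ofHom (Submodule.mapQ a b LinearMap.id h)

@[simp] lemma quotMap_comp {a b c : Ideal R} (h : a ≤ b) (h' : b ≤ c) :
    quotMap h ≫ quotMap h' = quotMap (h.trans h') := by
  ext
  simp [quotMap]

@[simp] lemma quotMap_refl {a : Ideal R} (h : a ≤ a) : quotMap h = 𝟙 _ := by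
  ext
  simp [quotMap]

/-- Restriction of `Ext` classes along `R ⧸ a → R ⧸ b`. -/
def pull {a b : Ideal R} (h : a ≤ b) (M : ModuleCat.{u} R) (i : ℕ) :
    Ext (ModuleCat.of R (R ⧸ b)) M i →ₗ[R] Ext (ModuleCat.of R (R ⧸ a)) M i :=
  (Ext.mk₀ (quotMap h)).precompOfLinear R M (zero_add i)

lemma pull_apply {a b : Ideal R} (h : a ≤ b) {M : ModuleCat.{u} R} {i : ℕ}
    (z : Ext (ModuleCat.of R (R ⧸ b)) M i) :
    pull h M i z = (Ext.mk₀ (quotMap h)).comp z (zero_add i) := rfl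

@[simp] lemma pull_pull {a b c : Ideal R} (h : a ≤ b) (h' : b ≤ c) {M : ModuleCat.{u} R} {i : ℕ}
    (z : Ext (ModuleCat.of R (R ⧸ c)) M i) :
    pull h M i (pull h' M i z) = pull (h.trans h') M i z := by
  rw [pull_apply, pull_apply, pull_apply, Ext.mk₀_comp_mk₀_assoc, quotMap_comp]

@[simp] lemma pull_refl {a : Ideal R} (h : a ≤ a) {M : ModuleCat.{u} R} {i : ℕ}
    (z : Ext (ModuleCat.of R (R ⧸ a)) M i) : pull h M i z = z := by
  simp [pull_apply]

lemma pull_comp {a b : Ideal R} (h : a ≤ b) {M N : ModuleCat.{u} R} {i j k : ℕ}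
    (z : Ext (ModuleCat.of R (R ⧸ b)) M i) (w : Ext M N j) (hk : i + j = k) :
    pull h N k (z.comp w hk) = (pull h M i z).comp w hk := by
  rw [pull_apply, pull_apply, Ext.comp_assoc _ _ _ (zero_add i) hk (by omega)]

variable (J : Ideal R)

/-- The coprojections of the colimit defining local cohomology. -/
def colimitMap (t : ℕ) (M : ModuleCat.{u} R) (i : ℕ) :
    OldExt R (ModuleCat.of R (R ⧸ J ^ t)) M i ⟶ (localCohomology J i).obj M :=
  (colimit.ι (localCohomology.diagram (localCohomology.idealPowersDiagram J) i) (op (op t))).app M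

/-- The canonical map from `Ext` to local cohomology. -/
def powGerm (t : ℕ) (M : ModuleCat.{u} R) (i : ℕ) :
    Ext (ModuleCat.of R (R ⧸ J ^ t)) M i →ₗ[R] (localCohomology J i).obj M :=
  (colimitMap J t M i).hom.comp (compareExt R (ModuleCat.of R (R ⧸ J ^ t)) M i)

lemma powGerm_pull {s t : ℕ} (h : t ≤ s) {M : ModuleCat.{u} R} {i : ℕ}
    (z : Ext (ModuleCat.of R (R ⧸ J ^ t)) M i) :
    powGerm J s M i (pull (Ideal.pow_le_pow_right h) M i z) = powGerm J t M i z := by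
  have hw := colimit.w (localCohomology.diagram (localCohomology.idealPowersDiagram J) i)
    (homOfLE h).op.op
  have := congrArg (fun f => (f.app M).hom (compareExt R _ M i z)) hw
  rw [powGerm, powGerm, LinearMap.comp_apply, LinearMap.comp_apply, pull_apply, compareExt_mk₀_comp]
  exact this

lemma powGerm_comp {t : ℕ} {M N : ModuleCat.{u} R} {i : ℕ}
    (z : Ext (ModuleCat.of R (R ⧸ J ^ t)) M i) (f : M ⟶ N) :
    powGerm J t N i (z.comp (Ext.mk₀ f) (add_zero i)) =
      ((localCohomology J i).map f).hom (powGerm J t M i z) := by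
  rw [powGerm, powGerm, LinearMap.comp_apply, LinearMap.comp_apply, compareExt_comp_mk₀]
  have := ((colimit.ι (localCohomology.diagram (localCohomology.idealPowersDiagram J) i)
    (op (op t))).naturality f)
  exact congrArg (fun g => g.hom (compareExt R _ M i z)) this

/-- The value of the local cohomology functor at `M` is a colimit. -/
def isColimitLocalCohomology (M : ModuleCat.{u} R) (i : ℕ) :
    IsColimit (((evaluation _ _).obj M).mapCocone
      (colimit.cocone (localCohomology.diagram (localCohomology.idealPowersDiagram J) i))) :=
  isColimitOfPreserves _ (colimit.isColimit _)

instance : PreservesColimitsOfShape ℕᵒᵖᵒᵖ (forget (ModuleCat.{u} R)) := by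
  have : PreservesFilteredColimitsOfSize.{0, 0} (forget (ModuleCat.{u} R)) :=
    preservesFilteredColimitsOfSize_shrink.{0, u, 0, u} _
  infer_instance

lemma exists_powGerm {M : ModuleCat.{u} R} {i : ℕ} (x : (localCohomology J i).obj M) :
    ∃ t z, powGerm J t M i z = x := by
  obtain ⟨t, e, he⟩ := Concrete.isColimit_exists_rep _ (isColimitLocalCohomology J M i) x
  obtain ⟨z, rfl⟩ := (compareExt_bijective (R := R) (ModuleCat.of R (R ⧸ J ^ t.unop.unop)) M i).2 e
  exact ⟨_, z, he⟩

lemma powGerm_eq_zero {t : ℕ} {M : ModuleCat.{u} R} {i : ℕ}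
    (z : Ext (ModuleCat.of R (R ⧸ J ^ t)) M i) (hz : powGerm J t M i z = 0) :
    ∃ s, ∃ h : t ≤ s, pull (Ideal.pow_le_pow_right h) M i z = 0 := by
  obtain ⟨s, f, g, h⟩ := Concrete.isColimit_exists_of_rep_eq _ (isColimitLocalCohomology J M i)
    (i := op (op t)) (j := op (op t)) (compareExt R (ModuleCat.of R (R ⧸ J ^ t)) M i z)
    0 (hz.trans (map_zero _).symm)
  have hts : t ≤ s.unop.unop := f.unop.unop.down.down
  refine ⟨s.unop.unop, hts, (compareExt_bijective (R := R) _ M i).1 ?_⟩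
  rw [pull_apply, compareExt_mk₀_comp, map_zero]
  exact h.trans (map_zero _)

/-- Ideals containing a power of `J`. -/
def ContainsPow (a : Ideal R) : Prop := ∃ s, J ^ s ≤ a

variable {J}

/-- The canonical map from `Ext^i(R/a, M)` to local cohomology, if `a` contains a power of `J`. -/
def germ {a : Ideal R} (ha : ContainsPow J a) (M : ModuleCat.{u} R) (i : ℕ) :
    Ext (ModuleCat.of R (R ⧸ a)) M i →ₗ[R] (localCohomology J i).obj M :=
  (powGerm J ha.choose M i).comp (pull ha.choose_spec M i)

lemma germ_eq {a : Ideal R} (ha : ContainsPow J a) {s : ℕ} (hs : J ^ s ≤ a) {M : ModuleCat.{u} R}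
    {i : ℕ} (z : Ext (ModuleCat.of R (R ⧸ a)) M i) :
    germ ha M i z = powGerm J s M i (pull hs M i z) := by
  rw [germ, LinearMap.comp_apply, ← powGerm_pull J (le_max_left ha.choose s),
    ← powGerm_pull J (le_max_right ha.choose s), pull_pull, pull_pull]

lemma germ_pull {a b : Ideal R} (ha : ContainsPow J a) (hb : ContainsPow J b) (h : a ≤ b)
    {M : ModuleCat.{u} R} {i : ℕ} (z : Ext (ModuleCat.of R (R ⧸ b)) M i) :
    germ ha M i (pull h M i z) = germ hb M i z := by
  obtain ⟨s, hs⟩ := id ha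
  rw [germ_eq _ hs, germ_eq _ (hs.trans h), pull_pull]

lemma germ_comp {a : Ideal R} (ha : ContainsPow J a) {M N : ModuleCat.{u} R} {i : ℕ}
    (z : Ext (ModuleCat.of R (R ⧸ a)) M i) (f : M ⟶ N) :
    germ ha N i (z.comp (Ext.mk₀ f) (add_zero i)) =
      ((localCohomology J i).map f).hom (germ ha M i z) := by
  obtain ⟨s, hs⟩ := id ha
  rw [germ_eq _ hs, germ_eq _ hs, pull_comp, powGerm_comp]

/-- A decreasing sequence of ideals cofinal with the powers of `J`. -/
structure IsCofinalWithPow (J : Ideal R) (a : ℕ → Ideal R) : Prop where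
  antitone : Antitone a
  containsPow : ∀ t, ContainsPow J (a t)
  exists_le_pow : ∀ s, ∃ t, a t ≤ J ^ s

variable {a : ℕ → Ideal R} (ha : IsCofinalWithPow J a)
include ha

/-- Together with `germ_eq_zero`, this replaces the powers of `J` by any cofinal sequence. -/
lemma IsCofinalWithPow.exists_germ {M : ModuleCat.{u} R} {i : ℕ} (x : (localCohomology J i).obj M) :
    ∃ t z, germ (ha.containsPow t) M i z = x := by
  obtain ⟨s, z, rfl⟩ := exists_powGerm J x
  obtain ⟨t, ht⟩ := ha.exists_le_pow s
  refine ⟨t, pull ht M i z, ?_⟩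
  have hp : ContainsPow J (J ^ s) := ⟨s, le_rfl⟩
  rw [germ_pull _ hp ht, germ_eq _ le_rfl, pull_refl]

lemma IsCofinalWithPow.germ_eq_zero {t : ℕ} {M : ModuleCat.{u} R} {i : ℕ}
    (z : Ext (ModuleCat.of R (R ⧸ a t)) M i) (hz : germ (ha.containsPow t) M i z = 0) :
    ∃ s, ∃ h : t ≤ s, pull (ha.antitone h) M i z = 0 := by
  obtain ⟨s, hs⟩ := ha.containsPow t
  rw [germ_eq _ hs] at hz
  obtain ⟨s', hss', h⟩ := powGerm_eq_zero J _ hz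
  obtain ⟨t', ht'⟩ := ha.exists_le_pow s'
  refine ⟨max t t', le_max_left _ _, ?_⟩
  have h1 : a (max t t') ≤ J ^ s' := (ha.antitone (le_max_right t t')).trans ht'
  have := congrArg (pull h1 M i) h
  rwa [pull_pull, pull_pull, map_zero] at this

end LocalCohomologyModel

/-! ### Pieces of the long exact sequence of local cohomology -/

section LongExactSequence

variable {R : Type u} [CommRing R] {J : Ideal R} {a : ℕ → Ideal R} (ha : IsCofinalWithPow J a)

include ha in
-- The vanishing of the image already holds at a finite stage, where the Ext sequence is exact.
lemma localCohomology_exact₂ {S : ShortComplex (ModuleCat.{u} R)} (hS : S.ShortExact) {i : ℕ}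
    (x : (localCohomology J i).obj S.X₂) (hx : ((localCohomology J i).map S.g).hom x = 0) :
    ∃ y, ((localCohomology J i).map S.f).hom y = x := by
  obtain ⟨t, z, rfl⟩ := ha.exists_germ x
  rw [← germ_comp] at hx
  obtain ⟨s, hs, h⟩ := ha.germ_eq_zero _ hx
  rw [pull_comp] at h
  obtain ⟨w, hw⟩ := Ext.covariant_sequence_exact₂ _ hS _ h
  exact ⟨germ (ha.containsPow s) _ _ w, by rw [← germ_comp, hw, germ_pull]⟩

include ha in
lemma localCohomology_map_f_injective {S : ShortComplex (ModuleCat.{u} R)} (hS : S.ShortExact)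
    {i : ℕ} (h3 : ∀ j, j + 1 = i → ∀ x : (localCohomology J j).obj S.X₃, x = 0) :
    Function.Injective ((localCohomology J i).map S.f).hom := by
  rw [injective_iff_map_eq_zero]
  intro x hx
  obtain ⟨t, z, rfl⟩ := ha.exists_germ x
  rw [← germ_comp] at hx
  obtain ⟨s, hs, h⟩ := ha.germ_eq_zero _ hx
  rw [pull_comp] at h
  rw [← germ_pull (ha.containsPow s) (ha.containsPow t) (ha.antitone hs)]
  rcases i with _ | i
  · have := hS.mono_f
    have h0 := Ext.postcomp_mk₀_injective_of_mono _ S.f (h.trans (map_zero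
      ((Ext.mk₀ S.f).postcomp _ (add_zero 0))).symm)
    rw [h0, map_zero]
  -- The class is the connecting image of some `w`, which itself dies at a later stage by `h3`.
  · obtain ⟨w, hw⟩ := Ext.covariant_sequence_exact₁ _ hS _ h rfl
    obtain ⟨s', hs', h'⟩ := ha.germ_eq_zero w (h3 i rfl _)
    rw [← hw, ← germ_pull (ha.containsPow s') (ha.containsPow s) (ha.antitone hs'), pull_comp, h',
      Ext.zero_comp, map_zero]

lemma localCohomology_map_smul_id {i : ℕ} (r : R) (M : ModuleCat.{u} R)
    (x : (localCohomology J i).obj M) :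
    ((localCohomology J i).map (r • 𝟙 M)).hom x = r • x := by
  obtain ⟨t, z, rfl⟩ := exists_powGerm J x
  rw [← powGerm_comp, ← Ext.smul_eq_comp_mk₀, map_smul]

lemma smul_ext_eq_comp {X M : ModuleCat.{u} R} {i : ℕ} (r : R) (z : Ext X M i) :
    r • z = (Ext.mk₀ (r • 𝟙 X)).comp z (zero_add i) := by
  rw [Ext.mk₀_smul, Ext.smul_comp, Ext.mk₀_id_comp]

lemma smul_ext_quotient {b : Ideal R} {M : ModuleCat.{u} R} {i : ℕ} {r : R} (hr : r ∈ b)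
    (z : Ext (ModuleCat.of R (R ⧸ b)) M i) : r • z = 0 := by
  have : r • 𝟙 (ModuleCat.of R (R ⧸ b)) = 0 := by
    ext
    change Ideal.Quotient.mk b (r * 1) = 0
    rwa [mul_one, Ideal.Quotient.eq_zero_iff_mem]
  rw [smul_ext_eq_comp, this, Ext.mk₀_zero, Ext.zero_comp]

lemma exists_pow_smul_localCohomology {i : ℕ} (M : ModuleCat.{u} R)
    (x : (localCohomology J i).obj M) : ∃ t, ∀ r ∈ J ^ t, r • x = 0 := by
  obtain ⟨t, z, rfl⟩ := exists_powGerm J x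
  exact ⟨t, fun r hr => by rw [← map_smul, smul_ext_quotient hr, map_zero]⟩

include ha in
-- Multiplication by `r` is injective on this local cohomology, yet every element is killed by a
-- power of `J`, hence of `r`.
lemma localCohomology_eq_zero_of_regular {M N : ModuleCat.{u} R} {r : R} (hr : r ∈ J)
    {g : M ⟶ N} (w : (r • 𝟙 M) ≫ g = 0) (hS : (ShortComplex.mk (r • 𝟙 M) g w).ShortExact)
    {i : ℕ} (h3 : ∀ j, j + 1 = i → ∀ x : (localCohomology J j).obj N, x = 0)
    (x : (localCohomology J i).obj M) : x = 0 := by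
  have hinj := localCohomology_map_f_injective ha hS h3
  obtain ⟨t, ht⟩ := exists_pow_smul_localCohomology M x
  have key : ∀ t : ℕ, ∀ y : (localCohomology J i).obj M, r ^ t • y = 0 → y = 0 := by
    intro t
    induction t with
    | zero => intro y hy; simpa using hy
    | succ t ih =>
      intro y hy
      apply ih
      apply hinj
      rw [map_zero]
      exact (localCohomology_map_smul_id r M _).trans (by rw [smul_smul, ← pow_succ', hy])
  exact key t x (ht _ (Ideal.pow_mem_pow hr t))

end LongExactSequence

/-! ### Injectivity on Ext of modules extended along a flat map -/

section BaseChange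

/-- Dimension shift along a projective middle term. `h0` is the shift from degree 1 to degree 0,
where $\mathrm{Ext}^1$ is only a quotient of Hom. -/
lemma smul_ext_X₃_injective {R : Type u} [CommRing R] {S : ShortComplex (ModuleCat.{u} R)}
    (hS : S.ShortExact) [Projective S.X₂] {M : ModuleCat.{u} R} {x : R}
    (h0 : ∀ (v : S.X₁ ⟶ M) (w : S.X₂ ⟶ M), S.f ≫ w = v ≫ (x • 𝟙 M) → ∃ w', S.f ≫ w' = v)
    {i : ℕ} (h1 : ∀ j, j + 1 = i → ∀ v : Ext S.X₁ M (j + 1), x • v = 0 → v = 0)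
    (z : Ext S.X₃ M (i + 1)) (hz : x • z = 0) : z = 0 := by
  obtain ⟨v, rfl⟩ := Ext.contravariant_sequence_exact₃ hS M z (Ext.eq_zero_of_projective _)
    (add_comm 1 i)
  rw [← Ext.comp_smul] at hz
  obtain ⟨w, hw⟩ := Ext.contravariant_sequence_exact₁ hS M _ _ hz
  rcases i with _ | i
  · obtain ⟨v, rfl⟩ := Ext.addEquiv₀.symm.surjective v
    obtain ⟨w, rfl⟩ := Ext.addEquiv₀.symm.surjective w
    simp only [Ext.addEquiv₀_symm_apply] at hw ⊢
    rw [Ext.mk₀_comp_mk₀, ← Ext.mk₀_smul] at hw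
    have hw : S.f ≫ w = v ≫ (x • 𝟙 M) := by
      simpa using Ext.addEquiv₀.symm.injective hw
    obtain ⟨w', rfl⟩ := h0 v w hw
    rw [← Ext.mk₀_comp_mk₀]
    exact hS.extClass_comp_assoc _
  · rw [Ext.eq_zero_of_projective w, Ext.comp_zero] at hw
    rw [h1 i rfl v hw.symm, Ext.comp_zero]

variable {A R : Type u} [CommRing A] [CommRing R] (φ : A →+* R)

/-- If multiplication by `x` on `M` has an `A`-linear left inverse, then `x` is injective on
`Ext` of modules that are extended from `A` along a flat map. -/
lemma smul_ext_extendScalars_injective (hφ : φ.Flat) {M : ModuleCat.{u} R} {x : R}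
    (ρ : (ModuleCat.restrictScalars φ).obj M ⟶ (ModuleCat.restrictScalars φ).obj M)
    (hρ : (ModuleCat.restrictScalars φ).map (x • 𝟙 M) ≫ ρ = 𝟙 _) (i : ℕ) :
    ∀ (T : ModuleCat.{u} A) (z : Ext ((ModuleCat.extendScalars φ).obj T) M i),
      x • z = 0 → z = 0 := by
  have hlim := ModuleCat.preservesFiniteLimits_extendScalars_of_flat hφ
  let adj := ModuleCat.extendRestrictScalarsAdj φ
  have hcolim : PreservesFiniteColimits (ModuleCat.extendScalars φ) :=
    have := adj.leftAdjoint_preservesColimits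
    inferInstance
  have hmono : Mono (x • 𝟙 M) := by
    have : Mono ((ModuleCat.restrictScalars φ).map (x • 𝟙 M)) := mono_of_mono_fac hρ
    exact (ModuleCat.restrictScalars φ).mono_of_mono_map this
  induction i with
  | zero =>
    intro T z hz
    apply Ext.postcomp_mk₀_injective_of_mono _ (x • 𝟙 M)
    rw [map_zero, ← hz, Ext.smul_eq_comp_mk₀]
    rfl
  | succ i ih =>
    intro T z hz
    let S : ShortComplex (ModuleCat.{u} A) :=
      ShortComplex.mk (kernel.ι (Projective.π T)) (Projective.π T) (kernel.condition _)
    have hS : S.ShortExact := { exact := ShortComplex.exact_kernel _ }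
    have hFS := hS.map_of_exact (ModuleCat.extendScalars φ)
    have hproj : Projective (S.map (ModuleCat.extendScalars φ)).X₂ :=
      adj.map_projective _ (Projective.projective_over T)
    have hlift : ∀ (v : (ModuleCat.extendScalars φ).obj S.X₁ ⟶ M)
        (w : (ModuleCat.extendScalars φ).obj S.X₂ ⟶ M),
        (ModuleCat.extendScalars φ).map S.f ≫ w = v ≫ (x • 𝟙 M) →
        ∃ w', (ModuleCat.extendScalars φ).map S.f ≫ w' = v := by
      intro v w hw
      -- By adjunction, maps out of the extended module are `A`-linear maps into `M`; there `ρ`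
      -- cancels `x`, and the extension `w` of `x • v` becomes one of `v`.
      have h1 := congrArg (· ≫ ρ) (congrArg (adj.homEquiv _ _) hw)
      rw [adj.homEquiv_naturality_left S.f w, adj.homEquiv_naturality_right v, Category.assoc,
        Category.assoc, hρ, Category.comp_id] at h1
      refine ⟨(adj.homEquiv _ _).symm (adj.homEquiv _ _ w ≫ ρ), ?_⟩
      rw [← Adjunction.homEquiv_naturality_left_symm, h1, Equiv.symm_apply_apply]
    refine smul_ext_X₃_injective hFS hlift (fun j hj v hv => ?_) z hz
    subst hj
    exact ih _ v hv

end BaseChange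

/-! ### Adjoining powers of one regular element to the ideals -/

section KoszulStep

variable {R : Type u} [CommRing R]

/-- If `x` is regular modulo `a`, the sequence `R/a → R/a → R/(a + (x))`. -/
lemma quot_smul_exact {a b : Ideal R} {x : R} (hb : b = a ⊔ Ideal.span {x}) (h : a ≤ b) :
    (x • 𝟙 (ModuleCat.of R (R ⧸ a))) ≫ quotMap h = 0 := by
  ext
  change Ideal.Quotient.mk b (x * 1) = 0
  rw [mul_one, Ideal.Quotient.eq_zero_iff_mem, hb]
  exact Ideal.mem_sup_right (Ideal.mem_span_singleton_self x)

/-- The short complex `R/a → R/a → R/(a + (x))`. -/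
abbrev quotComplex {a b : Ideal R} {x : R} (hb : b = a ⊔ Ideal.span {x}) (h : a ≤ b) :
    ShortComplex (ModuleCat.{u} R) :=
  ShortComplex.mk (x • 𝟙 (ModuleCat.of R (R ⧸ a))) (quotMap h) (quot_smul_exact hb h)

lemma quotComplex_shortExact {a b : Ideal R} {x : R} (hb : b = a ⊔ Ideal.span {x}) (h : a ≤ b)
    (hx : ∀ f, x * f ∈ a → f ∈ a) : (quotComplex hb h).ShortExact where
  exact := by
    rw [ShortComplex.moduleCat_exact_iff]
    intro y hy
    obtain ⟨f, rfl⟩ := Ideal.Quotient.mk_surjective y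
    change Ideal.Quotient.mk b f = 0 at hy
    rw [Ideal.Quotient.eq_zero_iff_mem, hb, Submodule.mem_sup] at hy
    obtain ⟨g, hg, k, hk, rfl⟩ := hy
    obtain ⟨c, rfl⟩ := Ideal.mem_span_singleton'.mp hk
    refine ⟨Ideal.Quotient.mk a c, ?_⟩
    change Ideal.Quotient.mk a (x * c) = _
    rw [Ideal.Quotient.eq, ← neg_mem_iff]
    convert hg using 1
    ring
  mono_f := by
    rw [ModuleCat.mono_iff_injective, injective_iff_map_eq_zero]
    intro y hy
    obtain ⟨f, rfl⟩ := Ideal.Quotient.mk_surjective y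
    change Ideal.Quotient.mk a (x * f) = 0 at hy
    rw [Ideal.Quotient.eq_zero_iff_mem] at hy
    exact Ideal.Quotient.eq_zero_iff_mem.mpr (hx f hy)
  epi_g := by
    rw [ModuleCat.epi_iff_surjective]
    intro y
    obtain ⟨f, rfl⟩ := Ideal.Quotient.mk_surjective y
    exact ⟨Ideal.Quotient.mk a f, rfl⟩

/-- A decreasing sequence of ideals `b t = a t + (x ^ t)` with `x` regular modulo all `a t`. -/
structure IsKoszulStep (a b : ℕ → Ideal R) (x : R) : Prop where
  antitone_left : Antitone a
  antitone_right : Antitone b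
  eq_sup : ∀ t, b t = a t ⊔ Ideal.span {x ^ t}
  regular : ∀ t f, x * f ∈ a t → f ∈ a t

namespace IsKoszulStep

variable {a b : ℕ → Ideal R} {x : R} (h : IsKoszulStep a b x)

include h

lemma le (t : ℕ) : a t ≤ b t := by
  rw [h.eq_sup]; exact le_sup_left

lemma shortExact (t : ℕ) : (quotComplex (h.eq_sup t) (h.le t)).ShortExact := by
  refine quotComplex_shortExact _ _ ?_
  generalize hk : x ^ t = y
  suffices ∀ k f, x ^ k * f ∈ a t → f ∈ a t from hk ▸ this t
  intro k
  induction k with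
  | zero => intro f hf; simpa using hf
  | succ k ih =>
    intro f hf
    exact ih _ (h.regular t _ (by rwa [pow_succ', mul_assoc] at hf))

/-- The projections form a morphism of short exact sequences only if the left one is multiplied by
$x^{s-t}$, since $x^{s-t} x^t = x^s$. Both uses of the Koszul step rest on this factor. -/
lemma pull_extClass {s t : ℕ} (hst : t ≤ s) {M : ModuleCat.{u} R} {i j : ℕ} (hij : 1 + i = j)
    (w : Ext (ModuleCat.of R (R ⧸ a t)) M i) :
    pull (h.antitone_right hst) M j ((h.shortExact t).extClass.comp w hij) =
      (h.shortExact s).extClass.comp (x ^ (s - t) • pull (h.antitone_left hst) M i w) hij := by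
  let φ : quotComplex (h.eq_sup s) (h.le s) ⟶ quotComplex (h.eq_sup t) (h.le t) :=
    { τ₁ := x ^ (s - t) • quotMap (h.antitone_left hst)
      τ₂ := quotMap (h.antitone_left hst)
      τ₃ := quotMap (h.antitone_right hst)
      comm₁₂ := by
        simp only [Linear.smul_comp, Linear.comp_smul, Category.id_comp, Category.comp_id,
          smul_smul, ← pow_add]
        congr 2
        omega
      comm₂₃ := by simp }
  have := ShortComplex.ShortExact.extClass_naturality (h.shortExact s) (h.shortExact t) φ
  have h2 : (h.shortExact s).extClass.comp (x ^ (s - t) • pull (h.antitone_left hst) M i w) hij =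
      ((h.shortExact s).extClass.comp (Ext.mk₀ φ.τ₁) (add_zero 1)).comp w hij := by
    rw [Ext.comp_assoc _ _ _ (add_zero 1) (zero_add i) (by omega)]
    congr 1
    rw [Ext.mk₀_smul, Ext.smul_comp]
    rfl
  rw [h2, this, Ext.comp_assoc _ _ _ (zero_add 1) hij (by omega)]
  rfl

lemma eventually_zero {M : ModuleCat.{u} R} {c : ℕ} (hc : x ^ c • 𝟙 M = 0)
    (ha : ∀ i t (z : Ext (ModuleCat.of R (R ⧸ a t)) M (i + 1)),
      ∃ s, ∃ hs : t ≤ s, pull (h.antitone_left hs) M (i + 1) z = 0)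
    (i t : ℕ) (z : Ext (ModuleCat.of R (R ⧸ b t)) M (i + 1)) :
    ∃ s, ∃ hs : t ≤ s, pull (h.antitone_right hs) M (i + 1) z = 0 := by
  obtain ⟨s, hs, hz⟩ := ha i t (pull (h.le t) M (i + 1) z)
  have h0 : (Ext.mk₀ (quotMap (h.le s))).comp (pull (h.antitone_right hs) M (i + 1) z)
      (zero_add (i + 1)) = 0 := by
    rw [← pull_apply, pull_pull]
    rwa [pull_pull] at hz
  obtain ⟨w, hw⟩ := Ext.contravariant_sequence_exact₃ (h.shortExact s) M _ h0 (add_comm 1 i)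
  refine ⟨s + c, by omega, ?_⟩
  rw [← pull_pull (h.antitone_right (Nat.le_add_right s c)) (h.antitone_right hs), ← hw,
    h.pull_extClass (Nat.le_add_right s c), Nat.add_sub_cancel_left, Ext.smul_eq_comp_mk₀, hc,
    Ext.mk₀_zero, Ext.comp_zero, Ext.comp_zero]

/-- Since $x^t$ kills `z` and `x` is injective on Ext over `a t`, the class `z` comes from a
connecting map; one transition then produces a factor `x`. In degree 0 such a `z` is zero. -/
lemma exists_pull_eq_smul {M : ModuleCat.{u} R}
    (hM : ∀ i t (z : Ext (ModuleCat.of R (R ⧸ a t)) M i), x • z = 0 → z = 0)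
    (i t : ℕ) (z : Ext (ModuleCat.of R (R ⧸ b t)) M i) :
    ∃ w, pull (h.antitone_right (Nat.le_succ t)) M i z = x • w := by
  have h0 : (Ext.mk₀ (quotMap (h.le t))).comp z (zero_add i) = 0 := by
    have hk : ∀ k, ∀ y : Ext (ModuleCat.of R (R ⧸ a t)) M i, x ^ k • y = 0 → y = 0 := by
      intro k
      induction k with
      | zero => intro y hy; simpa using hy
      | succ k ih => exact fun y hy => ih _ (hM _ _ _ (by rwa [smul_smul, ← pow_succ']))
    apply hk t
    have hz : x ^ t • z = 0 := by
      apply smul_ext_quotient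
      rw [h.eq_sup]
      exact Ideal.mem_sup_right (Ideal.mem_span_singleton_self _)
    rw [← Ext.comp_smul, hz, Ext.comp_zero]
  rcases i with _ | i
  · have := (h.shortExact t).epi_g
    have : z = 0 := Ext.precomp_mk₀_injective_of_epi M (quotMap (h.le t))
      (h0.trans (map_zero ((Ext.mk₀ (quotMap (h.le t))).precomp M (zero_add 0))).symm)
    exact ⟨0, by rw [this, map_zero, smul_zero]⟩
  · obtain ⟨w, hw⟩ := Ext.contravariant_sequence_exact₃ (h.shortExact t) M _ h0 (add_comm 1 i)
    refine ⟨(h.shortExact (t + 1)).extClass.comp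
      (pull (h.antitone_left (Nat.le_succ t)) M i w) (add_comm 1 i), ?_⟩
    rw [← hw, h.pull_extClass (Nat.le_succ t), Nat.succ_sub (le_refl t), Nat.sub_self, pow_one,
      Ext.comp_smul]

end IsKoszulStep

end KoszulStep
end
end MonomialLC

namespace MonomialLC
open CategoryTheory Limits Opposite Abelian MvPolynomial
noncomputable section
universe u

/-! ### Ideals of variable powers; vanishing and divisibility inputs -/

section Polynomial

variable {K : Type u} [Field K] {n : ℕ}

variable (K) in
/-- The ideal generated by the powers `X_l ^ e_l` for `l` in `F`. -/
def varPowIdeal (F : Finset (Fin n)) (e : Fin n → ℕ) : Ideal (MvPolynomial (Fin n) K) :=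
  Ideal.span ((fun l => X l ^ e l) '' (F : Set (Fin n)))

lemma mem_varPowIdeal {F : Finset (Fin n)} {e : Fin n → ℕ} {f : MvPolynomial (Fin n) K} :
    f ∈ varPowIdeal K F e ↔ ∀ m ∈ f.support, ∃ l ∈ F, e l ≤ m l := by
  have : (fun l : Fin n => (X l ^ e l : MvPolynomial (Fin n) K)) '' (F : Set (Fin n)) =
      (fun s => monomial s (1 : K)) '' ((fun l => Finsupp.single l (e l)) '' (F : Set (Fin n))) := by
    rw [Set.image_image]
    simp only [X_pow_eq_monomial]
  rw [varPowIdeal, this, mem_ideal_span_monomial_image]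
  simp [Finsupp.single_le_iff]

lemma varPowIdeal_insert (F : Finset (Fin n)) (j : Fin n) (e : Fin n → ℕ) :
    varPowIdeal K (insert j F) e = varPowIdeal K F e ⊔ Ideal.span {X j ^ e j} := by
  rw [varPowIdeal, varPowIdeal, ← Ideal.span_union, Finset.coe_insert, Set.image_insert_eq,
    Set.insert_eq, Set.union_comm]

lemma varPowIdeal_regular {F : Finset (Fin n)} {j : Fin n} (hj : j ∉ F) (e : Fin n → ℕ)
    (f : MvPolynomial (Fin n) K) (hf : X j * f ∈ varPowIdeal K F e) : f ∈ varPowIdeal K F e := by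
  rw [mem_varPowIdeal] at hf ⊢
  intro m hm
  obtain ⟨l, hl, h⟩ := hf (Finsupp.single j 1 + m) (by
    rw [support_X_mul]
    exact Finset.mem_map.mpr ⟨m, hm, rfl⟩)
  refine ⟨l, hl, ?_⟩
  rwa [Finsupp.add_apply, Finsupp.single_eq_of_ne (by rintro rfl; exact hj hl), zero_add] at h

lemma varPowIdeal_pow_regular {F : Finset (Fin n)} {j : Fin n} (hj : j ∉ F) (e : Fin n → ℕ)
    (c : ℕ) (f : MvPolynomial (Fin n) K) (hf : X j ^ c * f ∈ varPowIdeal K F e) :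
    f ∈ varPowIdeal K F e := by
  induction c generalizing f with
  | zero => simpa using hf
  | succ c ih => exact ih _ (varPowIdeal_regular hj e _ (by rwa [pow_succ', mul_assoc] at hf))

variable (K) in
/-- The ideal generated by the `t`-th powers of the variables in `F`. -/
abbrev powIdeal (F : Finset (Fin n)) (t : ℕ) : Ideal (MvPolynomial (Fin n) K) :=
  varPowIdeal K F fun _ => t

lemma powIdeal_antitone (F : Finset (Fin n)) : Antitone (powIdeal K F) := by
  intro s t hst f hf
  rw [mem_varPowIdeal] at hf ⊢
  intro m hm
  obtain ⟨l, hl, h⟩ := hf m hm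
  exact ⟨l, hl, hst.trans h⟩

lemma isKoszulStep_powIdeal {F : Finset (Fin n)} {j : Fin n} (hj : j ∉ F) :
    IsKoszulStep (powIdeal K F) (powIdeal K (insert j F)) (X j) where
  antitone_left := powIdeal_antitone F
  antitone_right := powIdeal_antitone _
  eq_sup _ := varPowIdeal_insert F j _
  regular _ := varPowIdeal_regular hj _

lemma X_mem_maxIdeal (j : Fin n) : X j ∈ maxIdeal K n :=
  Ideal.subset_span ⟨j, rfl⟩

lemma isCofinal_powIdeal : IsCofinalWithPow (maxIdeal K n) (powIdeal K Finset.univ) where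
  antitone := powIdeal_antitone _
  containsPow t := by
    refine Ideal.exists_pow_le_of_le_radical_of_fg ?_ (IsNoetherian.noetherian _)
    rw [maxIdeal, Ideal.span_le]
    rintro _ ⟨j, rfl⟩
    exact ⟨t, Ideal.subset_span ⟨j, by simp, rfl⟩⟩
  exists_le_pow s := by
    refine ⟨s, ?_⟩
    rw [powIdeal, varPowIdeal, Ideal.span_le]
    rintro _ ⟨j, -, rfl⟩
    exact Ideal.pow_mem_pow (X_mem_maxIdeal j) s

/-- Local cohomology in positive degrees vanishes on modules killed by powers of the variables. -/
lemma localCohomology_succ_eq_zero {M : ModuleCat.{u} (MvPolynomial (Fin n) K)} {c : ℕ}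
    (hc : ∀ j, (X j : MvPolynomial (Fin n) K) ^ c • 𝟙 M = 0) (i : ℕ)
    (x : (localCohomology (maxIdeal K n) (i + 1)).obj M) : x = 0 := by
  have key : ∀ F : Finset (Fin n), ∀ i t,
      ∀ z : Ext (ModuleCat.of (MvPolynomial (Fin n) K) (_ ⧸ powIdeal K F t)) M (i + 1),
      ∃ s, ∃ hs : t ≤ s, pull (powIdeal_antitone F hs) M (i + 1) z = 0 := by
    intro F
    induction F using Finset.induction_on with
    | empty =>
      intro i t z
      refine ⟨t, le_rfl, ?_⟩
      -- With no variables the quotient is the free module `S`, which has no positive Ext.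
      have hbot : powIdeal K (∅ : Finset (Fin n)) t = ⊥ := by simp [varPowIdeal]
      have : Projective (ModuleCat.of (MvPolynomial (Fin n) K) (_ ⧸ powIdeal K (∅ : Finset (Fin n)) t)) := by
        refine (IsProjective.iff_projective _).mp ?_
        rw [hbot]
        exact Module.Projective.of_equiv
          (Submodule.quotEquivOfEqBot (⊥ : Ideal (MvPolynomial (Fin n) K)) rfl).symm
      rw [Ext.eq_zero_of_projective z, map_zero]
    | insert j F hj ih =>
      intro i t z
      exact (isKoszulStep_powIdeal hj).eventually_zero (hc j) ih i t z
  obtain ⟨t, z, rfl⟩ := isCofinal_powIdeal.exists_germ x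
  obtain ⟨s, hs, h⟩ := key Finset.univ i t z
  rw [← germ_pull (isCofinal_powIdeal.containsPow s) _ (powIdeal_antitone _ hs), h, map_zero]

variable (K) in
/-- The inclusion of the polynomial ring in the variables other than `X_j`. -/
def inclusionOfOthers (j : Fin n) : MvPolynomial {l : Fin n // l ≠ j} K →+* MvPolynomial (Fin n) K :=
  (rename Subtype.val : _ →ₐ[K] MvPolynomial (Fin n) K).toRingHom

/-- The full ring is a polynomial ring over the subring of the other variables, hence free over it.
-/
lemma inclusionOfOthers_flat (j : Fin n) : (inclusionOfOthers K j).Flat := by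
  let e : MvPolynomial {l : Fin n // ¬ l ≠ j} (MvPolynomial {l : Fin n // l ≠ j} K) ≃ₐ[K]
      MvPolynomial (Fin n) K :=
    (sumAlgEquiv K _ _).symm.trans
      (renameEquiv K ((Equiv.sumComm _ _).trans (Equiv.sumCompl (fun l : Fin n => l ≠ j))))
  have h : inclusionOfOthers K j = e.toRingEquiv.toRingHom.comp C := by
    apply MvPolynomial.ringHom_ext
    · intro r
      simp [inclusionOfOthers, e]
    · intro l
      simp [inclusionOfOthers, e]
  rw [h]
  refine RingHom.Flat.comp ?_ (RingHom.Flat.of_bijective e.bijective)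
  exact (RingHom.flat_algebraMap_iff (R := MvPolynomial {l : Fin n // l ≠ j} K)
    (S := MvPolynomial {l : Fin n // ¬ l ≠ j} (MvPolynomial {l : Fin n // l ≠ j} K))).mpr
      inferInstance

lemma powIdeal_erase_eq_map (j : Fin n) (t : ℕ) :
    powIdeal K (Finset.univ.erase j) t =
      (Ideal.span (Set.range fun l => X l ^ t)).map (inclusionOfOthers K j) := by
  rw [Ideal.map_span, powIdeal, varPowIdeal]
  congr 1
  ext f
  simp [inclusionOfOthers]

/-- The quotient by powers of the other variables is extended from their polynomial ring, so the
flat base change statement applies. -/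
lemma smul_ext_powIdeal_injective (j : Fin n) {M : ModuleCat.{u} (MvPolynomial (Fin n) K)}
    (ρ : (ModuleCat.restrictScalars (inclusionOfOthers K j)).obj M ⟶
      (ModuleCat.restrictScalars (inclusionOfOthers K j)).obj M)
    (hρ : (ModuleCat.restrictScalars (inclusionOfOthers K j)).map
      ((X j : MvPolynomial (Fin n) K) • 𝟙 M) ≫ ρ = 𝟙 _) (i t : ℕ)
    (z : Ext (ModuleCat.of (MvPolynomial (Fin n) K) (_ ⧸ powIdeal K (Finset.univ.erase j) t)) M i)
    (hz : (X j : MvPolynomial (Fin n) K) • z = 0) : z = 0 := by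
  let I : Ideal (MvPolynomial {l : Fin n // l ≠ j} K) := Ideal.span (Set.range fun l => X l ^ t)
  let T := (ModuleCat.extendScalars (inclusionOfOthers K j)).obj
    (ModuleCat.of (MvPolynomial {l : Fin n // l ≠ j} K) (_ ⧸ I))
  have e : T ≅ ModuleCat.of (MvPolynomial (Fin n) K) (_ ⧸ powIdeal K (Finset.univ.erase j) t) := by
    rw [powIdeal_erase_eq_map]
    letI := (inclusionOfOthers K j).toAlgebra
    exact ((Algebra.TensorProduct.quotIdealMapEquivTensorQuot
      (MvPolynomial (Fin n) K) I).symm.toLinearEquiv).toModuleIso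
  have h1 : (Ext.mk₀ e.hom).comp z (zero_add i) = 0 := by
    apply smul_ext_extendScalars_injective _ (inclusionOfOthers_flat j) ρ hρ
    rw [← Ext.comp_smul, hz, Ext.comp_zero]
  have h2 := congrArg (fun y => (Ext.mk₀ e.inv).comp y (zero_add i)) h1
  simpa using h2

end Polynomial

/-! ### Monomial ideals and the Buchsbaum bound -/

section MonomialIdeals

variable {K : Type u} [Field K] {n : ℕ}

lemma IsMonomialIdeal.mem_iff {I : Ideal (MvPolynomial (Fin n) K)} (hI : IsMonomialIdeal I)
    {f : MvPolynomial (Fin n) K} : f ∈ I ↔ ∀ m ∈ f.support, monomial m (1 : K) ∈ I := by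
  obtain ⟨s, rfl⟩ := hI
  classical
  simp only [mem_ideal_span_monomial_image, support_monomial, one_ne_zero, if_false,
    Finset.mem_singleton, forall_eq]

lemma monomial_mem_of_le {I : Ideal (MvPolynomial (Fin n) K)} {m m' : Fin n →₀ ℕ} (h : m ≤ m')
    (hm : monomial m (1 : K) ∈ I) : monomial m' (1 : K) ∈ I := by
  have : monomial m' (1 : K) = monomial (m' - m) 1 * monomial m 1 := by
    rw [monomial_mul, tsub_add_cancel_of_le h, one_mul]
  rw [this]
  exact I.mul_mem_left _ hm

lemma le_rho {I : Ideal (MvPolynomial (Fin n) K)} {g : Fin n →₀ ℕ} (hg : g ∈ minGens I)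
    (j : Fin n) : g j ≤ rho I j :=
  le_csSup ((minGens_finite I).image _).bddAbove ⟨g, hg, rfl⟩

lemma exists_minGens_le {I : Ideal (MvPolynomial (Fin n) K)} {m : Fin n →₀ ℕ}
    (hm : monomial m (1 : K) ∈ I) : ∃ g ∈ minGens I, g ≤ m := by
  obtain ⟨g, hg, h⟩ := exists_minimal_le_of_wellFoundedLT
    (fun b => monomial b (1 : K) ∈ I) m hm
  exact ⟨g, h, hg⟩

lemma mem_support_X_pow_mul {j : Fin n} {c : ℕ} {f : MvPolynomial (Fin n) K} {m : Fin n →₀ ℕ} :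
    m ∈ (X j ^ c * f).support ↔ ∃ m' ∈ f.support, m = Finsupp.single j c + m' := by
  rw [X_pow_eq_monomial, mem_support_iff, coeff_monomial_mul']
  constructor
  · intro h
    split_ifs at h with hle
    · exact ⟨m - Finsupp.single j c, by simpa using h, (add_tsub_cancel_of_le hle).symm⟩
    · exact absurd rfl h
  · rintro ⟨m', hm', rfl⟩
    simpa using hm'

/-- Generators have $X_j$-exponent at most $\rho_j$, so whether $X_j^{\rho_j} m$ lies in $I$ does
not depend on the $X_j$-exponent of $m$. Hence the colon ideal $I : X_j^{\rho_j}$ is stable under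
division by $X_j$. -/
lemma IsMonomialIdeal.X_pow_rho_mul_divMonomial_mem {I : Ideal (MvPolynomial (Fin n) K)}
    (hI : IsMonomialIdeal I) (j : Fin n) {f : MvPolynomial (Fin n) K}
    (hf : X j ^ rho I j * f ∈ I) :
    X j ^ rho I j * (f.divMonomial (Finsupp.single j 1)) ∈ I := by
  rw [hI.mem_iff] at hf ⊢
  intro m hm
  obtain ⟨m', hm', rfl⟩ := mem_support_X_pow_mul.mp hm
  rw [mem_support_iff, coeff_divMonomial, ← mem_support_iff] at hm'
  obtain ⟨g, hg, hle⟩ := exists_minGens_le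
    (hf _ (mem_support_X_pow_mul.mpr ⟨_, hm', rfl⟩))
  refine monomial_mem_of_le (fun l => ?_) hg.1
  have h1 := hle l
  have h2 := le_rho hg l
  simp only [Finsupp.add_apply] at h1 ⊢
  by_cases hl : l = j
  · subst hl
    simp only [Finsupp.single_eq_same]
    omega
  · rw [Finsupp.single_eq_of_ne hl, Finsupp.single_eq_of_ne hl] at h1
    omega

lemma inclusionOfOthers_mul_divMonomial (j : Fin n) (a : MvPolynomial {l : Fin n // l ≠ j} K)
    (f : MvPolynomial (Fin n) K) :
    (inclusionOfOthers K j a * f).divMonomial (Finsupp.single j 1) =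
      inclusionOfOthers K j a * f.divMonomial (Finsupp.single j 1) := by
  induction a using MvPolynomial.induction_on generalizing f with
  | C r =>
    have : inclusionOfOthers K j (C r) = C r := by simp [inclusionOfOthers]
    rw [this]
    ext m
    simp [coeff_divMonomial, coeff_C_mul]
  | add a b ha hb => rw [map_add, add_mul, add_divMonomial, ha, hb, add_mul]
  | mul_X a l ih =>
    have : inclusionOfOthers K j (X l) = X l.1 := by simp [inclusionOfOthers]
    rw [map_mul, mul_assoc, ih, mul_assoc, this]
    congr 1
    ext m
    have hl : (Finsupp.single j 1 : Fin n →₀ ℕ) l.1 = 0 := Finsupp.single_eq_of_ne l.2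
    simp only [coeff_divMonomial, coeff_X_mul', Finsupp.mem_support_iff, Finsupp.add_apply, hl,
      zero_add]
    split_ifs with h
    · congr 1
      rw [add_tsub_assoc_of_le]
      simpa [Finsupp.single_le_iff] using Nat.one_le_iff_ne_zero.mpr h
    · rfl

/-- Division by `X_j` on a quotient of the polynomial ring, linear over the other variables. -/
def divX (j : Fin n) (J : Ideal (MvPolynomial (Fin n) K))
    (hJ : ∀ f ∈ J, f.divMonomial (Finsupp.single j 1) ∈ J) :
    (ModuleCat.restrictScalars (inclusionOfOthers K j)).obj
      (ModuleCat.of (MvPolynomial (Fin n) K) (_ ⧸ J)) ⟶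
    (ModuleCat.restrictScalars (inclusionOfOthers K j)).obj
      (ModuleCat.of (MvPolynomial (Fin n) K) (_ ⧸ J)) :=
  let g : (MvPolynomial (Fin n) K ⧸ J) →+ (MvPolynomial (Fin n) K ⧸ J) :=
    QuotientAddGroup.map J.toAddSubgroup J.toAddSubgroup
      { toFun := fun f => f.divMonomial (Finsupp.single j 1)
        map_zero' := zero_divMonomial _
        map_add' := fun f g => add_divMonomial f g _ } hJ
  ModuleCat.ofHom (X := (ModuleCat.restrictScalars (inclusionOfOthers K j)).obj
      (ModuleCat.of (MvPolynomial (Fin n) K) (_ ⧸ J)))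
    (Y := (ModuleCat.restrictScalars (inclusionOfOthers K j)).obj
      (ModuleCat.of (MvPolynomial (Fin n) K) (_ ⧸ J)))
    { toFun := g
      map_add' := map_add g
      map_smul' := by
        intro a y
        obtain ⟨f, rfl⟩ := Ideal.Quotient.mk_surjective y
        change Ideal.Quotient.mk J ((inclusionOfOthers K j a * f).divMonomial _) =
          Ideal.Quotient.mk J (inclusionOfOthers K j a * f.divMonomial _)
        rw [inclusionOfOthers_mul_divMonomial] }

/-- Local cohomology of a module on which `X_j` has a linear section is `X_j`-divisible. -/
lemma localCohomology_X_divisible (j : Fin n) (J : Ideal (MvPolynomial (Fin n) K))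
    (hJ : ∀ f ∈ J, f.divMonomial (Finsupp.single j 1) ∈ J) (i : ℕ) (x : H J i) :
    ∃ y : H J i, (X j : MvPolynomial (Fin n) K) • y = x := by
  have hρ : (ModuleCat.restrictScalars (inclusionOfOthers K j)).map
      ((X j : MvPolynomial (Fin n) K) • 𝟙 (ModuleCat.of (MvPolynomial (Fin n) K) (_ ⧸ J))) ≫
        divX j J hJ = 𝟙 _ := by
    ext y
    obtain ⟨f, rfl⟩ := Ideal.Quotient.mk_surjective y
    change Ideal.Quotient.mk J ((X j * f).divMonomial _) = Ideal.Quotient.mk J f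
    rw [X_mul_divMonomial]
  -- The variable `j` is adjoined last, after all the others.
  have hst := isKoszulStep_powIdeal (K := K) (Finset.notMem_erase j Finset.univ)
  rw [Finset.insert_erase (Finset.mem_univ j)] at hst
  obtain ⟨t, z, rfl⟩ := isCofinal_powIdeal.exists_germ x
  obtain ⟨w, hw⟩ := hst.exists_pull_eq_smul (smul_ext_powIdeal_injective j (divX j J hJ) hρ) i t z
  refine ⟨germ (isCofinal_powIdeal.containsPow (t + 1)) _ _ w, ?_⟩
  rw [← map_smul, ← hw, germ_pull]

/-- If a power of `X_j` kills local cohomology of `S/I`, then so does `X_j ^ ρ_j`. -/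
lemma IsMonomialIdeal.X_pow_rho_smul_eq_zero {I : Ideal (MvPolynomial (Fin n) K)}
    (hI : IsMonomialIdeal I) (j : Fin n) {i N : ℕ}
    (hN : ∀ x : H I i, (X j : MvPolynomial (Fin n) K) ^ N • x = 0) (x : H I i) :
    (X j : MvPolynomial (Fin n) K) ^ rho I j • x = 0 := by
  set r : MvPolynomial (Fin n) K := X j ^ rho I j with hr
  -- This is the colon ideal `I : r`; multiplication by `r` induces `v` from `S ⧸ J` back to `S ⧸
  -- I`.
  let J : Ideal (MvPolynomial (Fin n) K) := Submodule.comap (LinearMap.mulLeft _ r) I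
  have hIJ : I ≤ J := fun f hf => I.mul_mem_left _ hf
  let p : ModuleCat.of (MvPolynomial (Fin n) K) (_ ⧸ I) ⟶ ModuleCat.of _ (_ ⧸ J) := quotMap hIJ
  let v : ModuleCat.of (MvPolynomial (Fin n) K) (_ ⧸ J) ⟶ ModuleCat.of _ (_ ⧸ I) :=
    ModuleCat.ofHom (Submodule.mapQ J I (LinearMap.mulLeft _ r) le_rfl)
  have hpv : p ≫ v = r • 𝟙 _ := by
    ext
    change Ideal.Quotient.mk I (r * 1) = r • Ideal.Quotient.mk I 1
    rfl
  have hvp : v ≫ p = r • 𝟙 _ := by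
    ext
    change Ideal.Quotient.mk J (r * 1) = r • Ideal.Quotient.mk J 1
    rfl
  let F := localCohomology (maxIdeal K n) i
  have hdiv := localCohomology_X_divisible j J
    (fun f hf => hI.X_pow_rho_mul_divMonomial_mem j hf) i
  have hdivN : ∀ k, ∀ y : H J i, ∃ y' : H J i, (X j : MvPolynomial (Fin n) K) ^ k • y' = y := by
    intro k
    induction k with
    | zero => exact fun y => ⟨y, by simp⟩
    | succ k ih =>
      intro y
      obtain ⟨y', rfl⟩ := ih y
      obtain ⟨y'', rfl⟩ := hdiv y'
      exact ⟨y'', by rw [pow_succ, smul_smul]⟩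
  have hmap : ∀ y : H J i, ((F.map p).hom ((F.map v).hom y)) = r • y := by
    intro y
    rw [← localCohomology_map_smul_id, ← hvp, Functor.map_comp]
    rfl
  -- Write $y = X_j^N r y''$. As $r$ is `v` followed by `p`, this is the image under `p` of $X_j^N
  -- v(y'')$, zero by `hN`.
  have hzero : ∀ y : H J i, y = 0 := by
    intro y
    obtain ⟨y', rfl⟩ := hdivN N y
    obtain ⟨y'', rfl⟩ := hdivN (rho I j) y'
    rw [← hr, ← hmap, ← map_smul, hN, map_zero]
  have := localCohomology_map_smul_id (J := maxIdeal K n) (i := i) r _ x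
  rw [← this, ← hpv, Functor.map_comp]
  change (F.map v).hom ((F.map p).hom x) = 0
  rw [hzero ((F.map p).hom x), map_zero]

/-- Each element is killed by a power of $X_j$; over finitely many generators the largest exponent
works for all. -/
lemma exists_pow_smul_eq_zero_of_isFiniteLength {I : Ideal (MvPolynomial (Fin n) K)} {i : ℕ}
    (h : IsFiniteLength (MvPolynomial (Fin n) K) (H I i)) (j : Fin n) :
    ∃ N, ∀ x : H I i, (X j : MvPolynomial (Fin n) K) ^ N • x = 0 := by
  have := (isFiniteLength_iff_isNoetherian_isArtinian.mp h).1
  obtain ⟨s, hs⟩ := this.noetherian ⊤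
  have hex : ∀ x : H I i, ∃ t, (X j : MvPolynomial (Fin n) K) ^ t • x = 0 := fun x => by
    obtain ⟨t, ht⟩ := exists_pow_smul_localCohomology _ x
    exact ⟨t, ht _ (Ideal.pow_mem_pow (X_mem_maxIdeal j) t)⟩
  choose N hN using hex
  refine ⟨s.sup N, fun x => ?_⟩
  have hx : x ∈ Submodule.span (MvPolynomial (Fin n) K) (s : Set (H I i)) := hs ▸ trivial
  induction hx using Submodule.span_induction with
  | mem x hx =>
    obtain ⟨c, hc⟩ := Nat.exists_eq_add_of_le (Finset.le_sup (f := N) hx)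
    rw [hc, add_comm, pow_add, mul_smul, hN, smul_zero]
  | zero => exact smul_zero _
  | add x y _ _ hx hy => rw [smul_add, hx, hy, add_zero]
  | smul r x _ hx => rw [smul_comm, hx, smul_zero]

/-- Generalized Cohen–Macaulay monomial ideals are `(∑ ρ_j - n + 1)`-Buchsbaum. -/
theorem IsMonomialIdeal.isBuchsbaum {I : Ideal (MvPolynomial (Fin n) K)}
    (hI : IsMonomialIdeal I) (hgcm : IsGeneralizedCM I) :
    IsBuchsbaum ((∑ j, (rho I j : ℤ)) - n + 1) I := by
  intro i hi
  rw [eq_bot_iff, Submodule.smul_le]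
  rintro r hr x -
  have hX : ∀ j : Fin n, ∀ x : H I i, (X j : MvPolynomial (Fin n) K) ^ rho I j • x = 0 :=
    fun j => by
      obtain ⟨N, hN⟩ := exists_pow_smul_eq_zero_of_isFiniteLength (hgcm i hi) j
      exact hI.X_pow_rho_smul_eq_zero j hN
  suffices h : maxIdeal K n ^ ((∑ j, (rho I j : ℤ)) - n + 1).toNat ≤
      Module.annihilator (MvPolynomial (Fin n) K) (H I i) from
    (Submodule.mem_bot _).mpr (Module.mem_annihilator.mp (h hr) x)
  change idealOfVars (Fin n) K ^ _ ≤ _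
  rw [pow_idealOfVars_eq_span, Ideal.span_le]
  rintro _ ⟨m, hm, rfl⟩
  -- Pigeonhole: if all exponents were below $\rho_j$, the degree would be at most $\sum\rho_j - n$.
  -- All $\rho_j$ would then be positive, so truncation by `toNat` plays no role.
  obtain ⟨j, hj⟩ : ∃ j, rho I j ≤ m j := by
    by_contra! hlt
    have h1 : ∑ j, ((m j : ℤ) + 1) ≤ ∑ j, (rho I j : ℤ) :=
      Finset.sum_le_sum fun j _ => by exact_mod_cast hlt j
    rw [Finset.sum_add_distrib] at h1
    have h2 : ((∑ j, m j : ℕ) : ℤ) = ∑ j, (m j : ℤ) := by push_cast; rfl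
    have h3 : m.degree = ∑ j, m j := Finsupp.degree_eq_sum m
    have h4 : m.degree = ((∑ j, (rho I j : ℤ)) - n + 1).toNat := hm
    simp only [Finset.sum_const, Finset.card_univ, Fintype.card_fin, nsmul_eq_mul, mul_one] at h1
    omega
  refine Module.mem_annihilator.mpr fun x => ?_
  have : (monomial m (1 : K)) = monomial (m - Finsupp.single j (rho I j)) 1 * X j ^ rho I j := by
    rw [X_pow_eq_monomial, monomial_mul, one_mul, tsub_add_cancel_of_le]
    simpa [Finsupp.single_le_iff] using hj
  change monomial m (1 : K) • x = 0
  rw [this, mul_smul, hX, smul_zero]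

end MonomialIdeals

/-! ### First local cohomology of the quotient by an intersection -/

section IntersectionOfIdeals

variable {R : Type u} [CommRing R]

lemma localCohomology_prod_eq_zero {J : Ideal R} {a : ℕ → Ideal R} (ha : IsCofinalWithPow J a)
    {M N : Type u} [AddCommGroup M] [Module R M] [AddCommGroup N] [Module R N] {i : ℕ}
    (hM : ∀ x : (localCohomology J i).obj (ModuleCat.of R M), x = 0)
    (hN : ∀ x : (localCohomology J i).obj (ModuleCat.of R N), x = 0)
    (x : (localCohomology J i).obj (ModuleCat.of R (M × N))) : x = 0 := by
  let T : ShortComplex (ModuleCat.{u} R) :=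
    ShortComplex.mk (ModuleCat.ofHom (LinearMap.inl R M N)) (ModuleCat.ofHom (LinearMap.snd R M N))
      (by ext; rfl)
  have hT : T.ShortExact :=
    { exact := by
        rw [ShortComplex.moduleCat_exact_iff]
        rintro ⟨y, z⟩ hy
        exact ⟨y, Prod.ext rfl (Eq.symm hy)⟩
      mono_f := by
        rw [ModuleCat.mono_iff_injective]
        exact LinearMap.inl_injective
      epi_g := by
        rw [ModuleCat.epi_iff_surjective]
        exact LinearMap.snd_surjective }
  obtain ⟨y, rfl⟩ := localCohomology_exact₂ ha hT x (hN _)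
  have hy : y = 0 := hM y
  rw [hy, map_zero]

lemma exists_eq_smul_mk₀_quotMap {b c : Ideal R} (h : b ≤ c)
    (w : Ext (ModuleCat.of R (R ⧸ b)) (ModuleCat.of R (R ⧸ c)) 0) :
    ∃ r : R, w = r • Ext.mk₀ (quotMap h) := by
  obtain ⟨v, rfl⟩ := Ext.addEquiv₀.symm.surjective w
  obtain ⟨r, hr⟩ := Ideal.Quotient.mk_surjective
    (show R ⧸ c from v.hom (Submodule.Quotient.mk 1))
  have hv : v = r • quotMap h := by
    ext
    change v.hom (Submodule.Quotient.mk 1) = Ideal.Quotient.mk c (r * 1)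
    rw [mul_one, hr]
  exact ⟨r, by rw [Ext.addEquiv₀_symm_apply, hv, Ext.mk₀_smul]⟩

variable (b c : Ideal R)

/-- The diagonal map `R/(b ∩ c) → R/b × R/c`. -/
def interToProd : ModuleCat.of R (R ⧸ (b ⊓ c)) ⟶ ModuleCat.of R ((R ⧸ b) × (R ⧸ c)) :=
  ModuleCat.ofHom ((Submodule.mapQ (b ⊓ c) b LinearMap.id inf_le_left).prod
    (Submodule.mapQ (b ⊓ c) c LinearMap.id inf_le_right))

/-- The difference map `R/b × R/c → R/(b + c)`. -/
def prodToSup : ModuleCat.of R ((R ⧸ b) × (R ⧸ c)) ⟶ ModuleCat.of R (R ⧸ (b ⊔ c)) :=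
  ModuleCat.ofHom ((Submodule.mapQ b (b ⊔ c) LinearMap.id le_sup_left).comp
      (LinearMap.fst R (R ⧸ b) (R ⧸ c)) -
    (Submodule.mapQ c (b ⊔ c) LinearMap.id le_sup_right).comp (LinearMap.snd R (R ⧸ b) (R ⧸ c)))

lemma interToProd_comp_prodToSup : interToProd b c ≫ prodToSup b c = 0 := by
  ext
  exact sub_self (Ideal.Quotient.mk (b ⊔ c) 1)

/-- The short complex `R/(b ∩ c) → R/b × R/c → R/(b + c)`. -/
abbrev interComplex : ShortComplex (ModuleCat.{u} R) :=
  ShortComplex.mk (interToProd b c) (prodToSup b c) (interToProd_comp_prodToSup b c)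

lemma interComplex_shortExact : (interComplex b c).ShortExact where
  exact := by
    rw [ShortComplex.moduleCat_exact_iff]
    rintro ⟨y, z⟩ hy
    obtain ⟨f, rfl⟩ := Ideal.Quotient.mk_surjective y
    obtain ⟨g, rfl⟩ := Ideal.Quotient.mk_surjective z
    change Ideal.Quotient.mk (b ⊔ c) f - Ideal.Quotient.mk (b ⊔ c) g = 0 at hy
    rw [sub_eq_zero, Ideal.Quotient.eq, Submodule.mem_sup] at hy
    obtain ⟨p, hp, q, hq, h⟩ := hy
    refine ⟨Ideal.Quotient.mk (b ⊓ c) (f - p), ?_⟩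
    change (Ideal.Quotient.mk b (f - p), Ideal.Quotient.mk c (f - p)) = _
    refine Prod.ext (Ideal.Quotient.eq.mpr ?_) (Ideal.Quotient.eq.mpr ?_)
    · rw [sub_sub_cancel_left]
      exact neg_mem hp
    · convert hq using 1
      rw [eq_sub_of_add_eq h]
      ring
  mono_f := by
    rw [ModuleCat.mono_iff_injective, injective_iff_map_eq_zero]
    intro y hy
    obtain ⟨f, rfl⟩ := Ideal.Quotient.mk_surjective y
    change (Ideal.Quotient.mk b f, Ideal.Quotient.mk c f) = 0 at hy
    rw [Prod.mk_eq_zero, Ideal.Quotient.eq_zero_iff_mem, Ideal.Quotient.eq_zero_iff_mem] at hy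
    exact Ideal.Quotient.eq_zero_iff_mem.mpr hy
  epi_g := by
    rw [ModuleCat.epi_iff_surjective]
    intro y
    obtain ⟨f, rfl⟩ := Ideal.Quotient.mk_surjective y
    refine ⟨(Ideal.Quotient.mk b f, 0), ?_⟩
    change Ideal.Quotient.mk (b ⊔ c) f - Submodule.mapQ c (b ⊔ c) LinearMap.id le_sup_right 0 = _
    rw [map_zero, sub_zero]

variable {b c} {J : Ideal R}

/-- The class in `H^1_J(R/(b ∩ c))` of the extension by `R/(b + c)`. -/
def interClass (hbc : ContainsPow J (b ⊔ c)) :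
    (localCohomology J 1).obj (ModuleCat.of R (R ⧸ (b ⊓ c))) :=
  germ hbc (ModuleCat.of R (R ⧸ (b ⊓ c))) 1 (interComplex_shortExact b c).extClass

lemma smul_interClass (hbc : ContainsPow J (b ⊔ c)) {r : R} (hr : r ∈ b ⊔ c) :
    r • interClass hbc = 0 := by
  rw [interClass, ← map_smul]
  exact (congrArg _ (smul_ext_quotient hr _)).trans (map_zero _)

variable {a : ℕ → Ideal R} (ha : IsCofinalWithPow J a)

include ha

/-- By `h2`, at some stage the class is the connecting image of a map `R ⧸ a s → R ⧸ (b ⊔ c)`. After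
a further stage this is a multiple of the projection, whose connecting image is `interClass`. -/
lemma exists_eq_smul_interClass (hbc : ContainsPow J (b ⊔ c))
    (h2 : ∀ x : (localCohomology J 1).obj (ModuleCat.of R ((R ⧸ b) × (R ⧸ c))), x = 0)
    (x : (localCohomology J 1).obj (ModuleCat.of R (R ⧸ (b ⊓ c)))) :
    ∃ r : R, r • interClass hbc = x := by
  obtain ⟨t, z, rfl⟩ := ha.exists_germ x
  obtain ⟨s, hs, h⟩ := ha.germ_eq_zero (z.comp (Ext.mk₀ (interToProd b c)) (add_zero 1)) (h2 _)
  rw [pull_comp] at h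
  obtain ⟨w, hw⟩ := Ext.covariant_sequence_exact₁ _ (interComplex_shortExact b c) _ h (zero_add 1)
  obtain ⟨q, hq⟩ := id hbc
  obtain ⟨p, hp⟩ := ha.exists_le_pow q
  have hle : a (max s p) ≤ b ⊔ c := (ha.antitone (le_max_right s p)).trans (hp.trans hq)
  obtain ⟨r, hr⟩ := exists_eq_smul_mk₀_quotMap hle
    (pull (ha.antitone (le_max_left s p)) (ModuleCat.of R (R ⧸ (b ⊔ c))) 0 w)
  refine ⟨r, ?_⟩
  have h1 : germ (ha.containsPow t) _ 1 z = germ (ha.containsPow (max s p)) _ 1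
      (pull (ha.antitone (le_max_left s p)) _ 1 (pull (ha.antitone hs) _ 1 z)) := by
    rw [germ_pull _ (ha.containsPow s), germ_pull _ (ha.containsPow t)]
  have h2 : interClass hbc = germ (ha.containsPow (max s p)) _ 1
      (pull hle _ 1 (interComplex_shortExact b c).extClass) :=
    (germ_pull _ hbc hle _).symm
  rw [h1, h2, ← map_smul, ← hw, pull_comp]
  refine congrArg _ ?_
  refine Eq.trans ?_ (congrArg (fun v => v.comp (interComplex_shortExact b c).extClass
    (zero_add 1)) hr.symm)
  rw [Ext.smul_comp]
  rfl

/-- At some stage `r` times the projection lifts to `R ⧸ b × R ⧸ c`. The image of 1 under the lift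
is killed by `a s`, which contains nonzerodivisors on both factors, so the lift is zero. -/
lemma mem_sup_of_smul_interClass_eq_zero (hbc : ContainsPow J (b ⊔ c))
    (hb : ∀ s, ∃ p ∈ a s, ∀ f, p * f ∈ b → f ∈ b) (hc : ∀ s, ∃ p ∈ a s, ∀ f, p * f ∈ c → f ∈ c)
    {r : R} (hr : r • interClass hbc = 0) : r ∈ b ⊔ c := by
  have hS := interComplex_shortExact b c
  obtain ⟨q, hq⟩ := id hbc
  obtain ⟨p, hp⟩ := ha.exists_le_pow q
  rw [interClass, ← map_smul, ← germ_pull (ha.containsPow p) _ (hp.trans hq)] at hr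
  obtain ⟨s, hs, h⟩ := ha.germ_eq_zero _ hr
  have hle : a s ≤ b ⊔ c := (ha.antitone hs).trans (hp.trans hq)
  have h' : (Ext.mk₀ (r • quotMap hle)).comp hS.extClass (zero_add 1) = 0 := by
    rw [← h, pull_pull, map_smul, pull_apply, Ext.mk₀_smul, Ext.smul_comp]
  obtain ⟨w, hw⟩ := Ext.covariant_sequence_exact₃ _ hS _ (zero_add 1) h'
  obtain ⟨v, rfl⟩ := Ext.addEquiv₀.symm.surjective w
  rw [Ext.addEquiv₀_symm_apply, Ext.mk₀_comp_mk₀] at hw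
  have hv : v ≫ prodToSup b c = r • quotMap hle := by
    simpa using Ext.addEquiv₀.symm.injective hw
  obtain ⟨y, hy⟩ : ∃ y : (R ⧸ b) × (R ⧸ c), y = v.hom (Submodule.Quotient.mk 1) := ⟨_, rfl⟩
  have hkill : ∀ g ∈ a s, g • y = 0 := by
    intro g hg
    rw [hy]
    refine (map_smul v.hom g (Submodule.Quotient.mk 1)).symm.trans ?_
    have : g • (Submodule.Quotient.mk 1 : R ⧸ a s) = 0 := by
      rw [← Submodule.Quotient.mk_smul, Submodule.Quotient.mk_eq_zero]
      simpa using hg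
    exact (congrArg v.hom this).trans (map_zero _)
  have h1 : (prodToSup b c).hom y = Ideal.Quotient.mk (b ⊔ c) (r * 1) := by
    rw [hy]
    exact congrArg (fun k => k.hom (Submodule.Quotient.mk 1)) hv
  obtain ⟨y1, y2⟩ := y
  obtain ⟨f, rfl⟩ := Ideal.Quotient.mk_surjective y1
  obtain ⟨g, rfl⟩ := Ideal.Quotient.mk_surjective y2
  obtain ⟨p1, hp1, hreg1⟩ := hb s
  obtain ⟨p2, hp2, hreg2⟩ := hc s
  have hf : f ∈ b := hreg1 f (Ideal.Quotient.eq_zero_iff_mem.mp (congrArg Prod.fst (hkill p1 hp1)))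
  have hg : g ∈ c := hreg2 g (Ideal.Quotient.eq_zero_iff_mem.mp (congrArg Prod.snd (hkill p2 hp2)))
  change Ideal.Quotient.mk (b ⊔ c) f - Ideal.Quotient.mk (b ⊔ c) g = _ at h1
  rw [Ideal.Quotient.eq_zero_iff_mem.mpr (Ideal.mem_sup_left hf),
    Ideal.Quotient.eq_zero_iff_mem.mpr (Ideal.mem_sup_right hg), sub_zero, mul_one] at h1
  exact Ideal.Quotient.eq_zero_iff_mem.mp h1.symm

end IntersectionOfIdeals

/-! ### Quotients by powers of variables -/

section CompleteIntersections

variable {K : Type u} [Field K] {n : ℕ}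

lemma X_pow_mem_varPowIdeal {F : Finset (Fin n)} {j : Fin n} (hj : j ∈ F) (e : Fin n → ℕ) :
    (X j ^ e j : MvPolynomial (Fin n) K) ∈ varPowIdeal K F e :=
  Ideal.subset_span ⟨j, hj, rfl⟩

/-- Local cohomology of `S/(X_l ^ e_l : l ∈ F)` is concentrated in degree `n - |F|`. -/
lemma localCohomology_varPowIdeal_eq_zero {e : Fin n → ℕ} (he : ∀ j, 1 ≤ e j)
    (F : Finset (Fin n)) (i : ℕ) (hi : i + F.card ≠ n) (x : H (varPowIdeal K F e) i) : x = 0 := by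
  obtain ⟨d, hd⟩ : ∃ d, F.card + d = n :=
    ⟨n - F.card, Nat.add_sub_cancel' ((Finset.card_le_univ F).trans_eq (Fintype.card_fin n))⟩
  -- Induction on the number `d` of variables outside `F`: each missing one gives a regular element
  -- $X_j^{e_j}$ of the maximal ideal.
  induction d generalizing F i with
  | zero =>
    have hF : F = Finset.univ := by
      rw [← Finset.card_eq_iff_eq_univ, Fintype.card_fin]
      exact hd
    obtain ⟨k, rfl⟩ : ∃ k, i = k + 1 := Nat.exists_eq_succ_of_ne_zero (by rintro rfl; omega)
    -- The sum is a uniform exponent, at least every `e j`.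
    refine localCohomology_succ_eq_zero (c := ∑ l, e l) (fun j => ?_) k x
    ext
    change Ideal.Quotient.mk _ (X j ^ (∑ l, e l) * 1) = 0
    rw [mul_one, Ideal.Quotient.eq_zero_iff_mem]
    exact Ideal.pow_mem_of_pow_mem _ (X_pow_mem_varPowIdeal (hF ▸ Finset.mem_univ j) e)
      (Finset.single_le_sum (fun _ _ => Nat.zero_le _) (Finset.mem_univ j))
  | succ d ih =>
    obtain ⟨j, hj⟩ : ∃ j, j ∉ F := by
      by_contra! h
      rw [Finset.eq_univ_iff_forall.mpr h, Finset.card_univ, Fintype.card_fin] at hd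
      omega
    have hle : varPowIdeal K F e ≤ varPowIdeal K (insert j F) e := by
      rw [varPowIdeal_insert]; exact le_sup_left
    have hcard := Finset.card_insert_of_notMem hj
    refine localCohomology_eq_zero_of_regular isCofinal_powIdeal
      (Ideal.pow_mem_of_mem _ (X_mem_maxIdeal j) _ (he j)) _
      (quotComplex_shortExact (varPowIdeal_insert F j e) hle (varPowIdeal_pow_regular hj e _))
      (fun i' hi' y => ih (insert j F) i' (by omega) y (by omega)) x

lemma finite_quotient_varPowIdeal (e : Fin n → ℕ) (he : ∀ j, 1 ≤ e j) :
    Module.Finite K (MvPolynomial (Fin n) K ⧸ varPowIdeal K Finset.univ e) := by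
  have : Algebra.IsIntegral K (MvPolynomial (Fin n) K ⧸ varPowIdeal K Finset.univ e) := by
    constructor
    intro y
    obtain ⟨f, rfl⟩ := Ideal.Quotient.mk_surjective y
    induction f using MvPolynomial.induction_on with
    | C r => exact isIntegral_algebraMap (x := r)
    | add f g hf hg => rw [map_add]; exact hf.add hg
    | mul_X f j hf =>
      rw [map_mul]
      refine hf.mul (IsIntegral.of_pow (he j) ?_)
      rw [← map_pow, Ideal.Quotient.eq_zero_iff_mem.mpr (X_pow_mem_varPowIdeal (by simp) e)]
      exact isIntegral_zero
  exact Algebra.IsIntegral.finite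

lemma isFiniteLength_quotient_varPowIdeal (e : Fin n → ℕ) (he : ∀ j, 1 ≤ e j) :
    IsFiniteLength (MvPolynomial (Fin n) K)
      (MvPolynomial (Fin n) K ⧸ varPowIdeal K Finset.univ e) := by
  have := finite_quotient_varPowIdeal (K := K) e he
  rw [isFiniteLength_iff_isNoetherian_isArtinian]
  exact ⟨inferInstance, isArtinian_of_tower K inferInstance⟩

end CompleteIntersections

/-! ### Krull dimension of the examples -/

section Dimension

/-- A whole chain of primes lies above its smallest member, hence above the ideal `b` chosen for
that member. -/
lemma ringKrullDim_quotient_le {R : Type u} [CommRing R] {I : Ideal R} {d : WithBot ℕ∞}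
    (h : ∀ P : Ideal R, P.IsPrime → I ≤ P → ∃ b ≤ P, ringKrullDim (R ⧸ b) ≤ d) :
    ringKrullDim (R ⧸ I) ≤ d := by
  rw [ringKrullDim_quotient, Order.krullDim]
  refine iSup_le fun p => ?_
  obtain ⟨b, hb, hd⟩ := h p.head.1.asIdeal p.head.1.isPrime p.head.2
  refine le_trans ?_ hd
  rw [ringKrullDim_quotient]
  let q : LTSeries (PrimeSpectrum.zeroLocus (b : Set R)) :=
    { length := p.length
      toFun := fun i => ⟨(p i).1, hb.trans (p.monotone (Fin.zero_le i))⟩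
      step := fun i => p.step i }
  exact le_iSup (fun p : LTSeries (PrimeSpectrum.zeroLocus (b : Set R)) =>
    (p.length : WithBot ℕ∞)) q

variable {K : Type u} [Field K] {n : ℕ}

lemma ringKrullDim_mvPolynomial_others (F : Finset (Fin n)) :
    ringKrullDim (MvPolynomial {l // l ∉ F} K) = ((n - F.card : ℕ) : WithBot ℕ∞) := by
  rw [MvPolynomial.ringKrullDim_of_isNoetherianRing, ringKrullDim_eq_zero_of_field, zero_add]
  simp

lemma ringKrullDim_quotient_varPowIdeal_one_le (F : Finset (Fin n)) :
    ringKrullDim (MvPolynomial (Fin n) K ⧸ varPowIdeal K F 1) ≤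
      ((n - F.card : ℕ) : WithBot ℕ∞) := by
  rw [← ringKrullDim_mvPolynomial_others (K := K) F]
  refine ringKrullDim_le_of_surjective ((Ideal.Quotient.mk (varPowIdeal K F 1)).comp
    (rename Subtype.val : MvPolynomial {l // l ∉ F} K →ₐ[K] _).toRingHom) ?_
  intro y
  obtain ⟨f, rfl⟩ := Ideal.Quotient.mk_surjective y
  induction f using MvPolynomial.induction_on with
  | C r => exact ⟨C r, by simp⟩
  | add f g hf hg =>
    obtain ⟨p, hp⟩ := hf
    obtain ⟨q, hq⟩ := hg
    exact ⟨p + q, by rw [map_add, hp, hq, map_add]⟩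
  | mul_X f j hf =>
    by_cases hj : j ∈ F
    · refine ⟨0, ?_⟩
      have := X_pow_mem_varPowIdeal (K := K) hj 1
      rw [Pi.one_apply, pow_one] at this
      rw [map_zero, map_mul, Ideal.Quotient.eq_zero_iff_mem.mpr this, mul_zero]
    · obtain ⟨p, hp⟩ := hf
      exact ⟨p * X ⟨j, hj⟩, by rw [map_mul, hp, map_mul]; simp⟩

/-- Setting the variables of `F` to zero maps the quotient onto a polynomial ring in the remaining
ones. -/
lemma le_ringKrullDim_quotient {F : Finset (Fin n)} {e : Fin n → ℕ} (he : ∀ j, 1 ≤ e j)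
    {I : Ideal (MvPolynomial (Fin n) K)} (hI : I ≤ varPowIdeal K F e) :
    ((n - F.card : ℕ) : WithBot ℕ∞) ≤ ringKrullDim (MvPolynomial (Fin n) K ⧸ I) := by
  rw [← ringKrullDim_mvPolynomial_others (K := K) F]
  let φ : MvPolynomial (Fin n) K →ₐ[K] MvPolynomial {l // l ∉ F} K :=
    aeval fun l => if h : l ∉ F then X ⟨l, h⟩ else 0
  have hφ : varPowIdeal K F e ≤ RingHom.ker φ.toRingHom := by
    rw [varPowIdeal, Ideal.span_le]
    rintro _ ⟨l, hl, rfl⟩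
    have hl' : l ∈ F := hl
    have he' := he l
    change φ (X l ^ e l) = 0
    rw [map_pow, aeval_X, dif_neg (not_not.mpr hl'), zero_pow (by omega)]
  refine ringKrullDim_le_of_surjective
    (Ideal.Quotient.lift I φ.toRingHom fun f hf => hφ (hI hf)) ?_
  refine Ideal.Quotient.lift_surjective_of_surjective _ _ fun f => ⟨rename Subtype.val f, ?_⟩
  change φ (rename Subtype.val f) = f
  have : φ.comp (rename Subtype.val) = AlgHom.id K _ := by
    ext l
    simp [φ, l.2]
  exact DFunLike.congr_fun this f

lemma varPowIdeal_one_le_of_isPrime {F : Finset (Fin n)} {e : Fin n → ℕ}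
    {P : Ideal (MvPolynomial (Fin n) K)} (hP : P.IsPrime) (h : varPowIdeal K F e ≤ P) :
    varPowIdeal K F 1 ≤ P := by
  rw [varPowIdeal, Ideal.span_le]
  rintro _ ⟨l, hl, rfl⟩
  simpa using hP.mem_of_pow_mem _ (h (X_pow_mem_varPowIdeal hl e))

lemma ringKrullDim_quotient_varPowIdeal_inf {F G : Finset (Fin n)} {e : Fin n → ℕ}
    (he : ∀ j, 1 ≤ e j) (hFG : F.card = G.card) :
    ringKrullDim (MvPolynomial (Fin n) K ⧸ varPowIdeal K F e ⊓ varPowIdeal K G e) =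
      ((n - F.card : ℕ) : WithBot ℕ∞) := by
  apply le_antisymm
  · refine ringKrullDim_quotient_le fun P hP hle => ?_
    rcases hP.inf_le.mp hle with h | h
    · exact ⟨_, varPowIdeal_one_le_of_isPrime hP h, ringKrullDim_quotient_varPowIdeal_one_le F⟩
    · refine ⟨_, varPowIdeal_one_le_of_isPrime hP h, ?_⟩
      rw [hFG]
      exact ringKrullDim_quotient_varPowIdeal_one_le G
  · exact le_ringKrullDim_quotient he inf_le_left

end Dimension

/-! ### Largest exponents for an intersection of two such ideals -/

section Exponents

variable {K : Type u} [Field K] {n : ℕ}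

lemma monomial_mem_varPowIdeal {F : Finset (Fin n)} {e : Fin n → ℕ} {m : Fin n →₀ ℕ} :
    monomial m (1 : K) ∈ varPowIdeal K F e ↔ ∃ l ∈ F, e l ≤ m l := by
  classical
  rw [mem_varPowIdeal]
  simp [support_monomial]

lemma isMonomialIdeal_varPowIdeal_inf (F G : Finset (Fin n)) (e : Fin n → ℕ) :
    IsMonomialIdeal (varPowIdeal K F e ⊓ varPowIdeal K G e) := by
  refine ⟨{m | monomial m (1 : K) ∈ varPowIdeal K F e ⊓ varPowIdeal K G e}, ?_⟩
  ext f
  rw [mem_ideal_span_monomial_image, Ideal.mem_inf, mem_varPowIdeal, mem_varPowIdeal]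
  simp only [Set.mem_ofPred_eq, Ideal.mem_inf, monomial_mem_varPowIdeal]
  constructor
  · exact fun h m hm => ⟨m, ⟨h.1 m hm, h.2 m hm⟩, le_rfl⟩
  · intro h
    constructor
    · intro m hm
      obtain ⟨m', ⟨⟨l, hl, h'⟩, -⟩, hle⟩ := h m hm
      exact ⟨l, hl, h'.trans (hle l)⟩
    · intro m hm
      obtain ⟨m', ⟨-, ⟨l, hl, h'⟩⟩, hle⟩ := h m hm
      exact ⟨l, hl, h'.trans (hle l)⟩

lemma rho_varPowIdeal_inf {F G : Finset (Fin n)} (hFG : Disjoint F G) (hG : G.Nonempty)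
    {e : Fin n → ℕ} (he : ∀ j, 1 ≤ e j) {j : Fin n} (hj : j ∈ F) :
    rho (varPowIdeal K F e ⊓ varPowIdeal K G e) j = e j := by
  apply le_antisymm
  · apply csSup_le'
    rintro _ ⟨g, hg, rfl⟩
    by_contra! hlt
    have hmem := hg.1
    simp only [Ideal.mem_inf, monomial_mem_varPowIdeal] at hmem
    obtain ⟨⟨p, hp, hp'⟩, ⟨q, hq, hq'⟩⟩ := hmem
    have key : ∀ l, e l ≤ g l → e l ≤ (g.update j (e j)) l := by
      intro l hl
      by_cases h : l = j
      · subst h; simp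
      · simpa [Finsupp.update_apply, h] using hl
    -- Lowering an exponent larger than `e j` to `e j` stays in the ideal, against minimality of
    -- `g`.
    have hle : g.update j (e j) ≤ g := by
      intro l
      by_cases h : l = j
      · subst h; simpa using hlt.le
      · simp [Finsupp.update_apply, h]
    have := hg.2 (y := g.update j (e j)) (by
      simp only [Ideal.mem_inf, monomial_mem_varPowIdeal]
      exact ⟨⟨p, hp, key p hp'⟩, ⟨q, hq, key q hq'⟩⟩) hle j
    simp at this
    omega
  · obtain ⟨l, hl⟩ := hG
    have hjl : j ≠ l := fun h => Finset.disjoint_left.mp hFG hj (h ▸ hl)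
    -- Disjointness makes $X_j^{e_j} X_l^{e_l}$ a minimal generator, so the value `e j` is attained.
    let g : Fin n →₀ ℕ := Finsupp.single j (e j) + Finsupp.single l (e l)
    have hgj : g j = e j := by simp [g, hjl]
    have hgl : g l = e l := by simp [g, hjl.symm]
    have hg0 : ∀ p, p ≠ j → p ≠ l → g p = 0 := by
      intro p h1 h2
      simp [g, h1.symm, h2.symm]
    have hg : g ∈ minGens (varPowIdeal K F e ⊓ varPowIdeal K G e) := by
      constructor
      · simp only [Ideal.mem_inf, monomial_mem_varPowIdeal]
        exact ⟨⟨j, hj, hgj.ge⟩, ⟨l, hl, hgl.ge⟩⟩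
      · intro b hb hle p
        simp only [Ideal.mem_inf, monomial_mem_varPowIdeal] at hb
        obtain ⟨⟨q, hq, hq'⟩, ⟨r, hr, hr'⟩⟩ := hb
        have hcases : ∀ q, e q ≤ b q → q = j ∨ q = l := by
          intro q hq
          by_contra! h
          have h1 := hle q
          have h2 := he q
          rw [hg0 q h.1 h.2] at h1
          omega
        have hqj : q = j := (hcases q hq').resolve_right
          (by rintro rfl; exact Finset.disjoint_left.mp hFG hq hl)
        have hrl : r = l := (hcases r hr').resolve_left
          (by rintro rfl; exact Finset.disjoint_left.mp hFG hj hr)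
        subst hqj hrl
        by_cases h1 : p = q
        · subst h1; rwa [hgj]
        · by_cases h2 : p = r
          · subst h2; rwa [hgl]
          · rw [hg0 p h1 h2]; exact Nat.zero_le _
    exact hgj.ge.trans (le_rho hg j)

end Exponents

/-! ### Two coordinate subspaces meeting only at the origin -/

section TwoSubspaces

variable {K : Type u} [Field K] {n : ℕ} {F G : Finset (Fin n)} {e : Fin n → ℕ}

lemma varPowIdeal_union (F G : Finset (Fin n)) (e : Fin n → ℕ) :
    varPowIdeal K F e ⊔ varPowIdeal K G e = varPowIdeal K (F ∪ G) e := by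
  rw [varPowIdeal, varPowIdeal, varPowIdeal, ← Ideal.span_union, ← Set.image_union,
    Finset.coe_union]

lemma containsPow_varPowIdeal_univ (e : Fin n → ℕ) :
    ContainsPow (maxIdeal K n) (varPowIdeal K Finset.univ e) := by
  refine Ideal.exists_pow_le_of_le_radical_of_fg ?_ (IsNoetherian.noetherian _)
  rw [maxIdeal, Ideal.span_le]
  rintro _ ⟨j, rfl⟩
  exact ⟨e j, X_pow_mem_varPowIdeal (Finset.mem_univ j) e⟩

/-- The quotient by the sum has cohomology only in degree 0, so for `i ≠ 1` the module embeds in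
that of the product, which vanishes. -/
lemma localCohomology_varPowIdeal_inf_eq_zero (he : ∀ j, 1 ≤ e j) (hFG : F ∪ G = Finset.univ)
    {i : ℕ} (h1 : i ≠ 1) (hF : i + F.card ≠ n) (hG : i + G.card ≠ n)
    (x : H (varPowIdeal K F e ⊓ varPowIdeal K G e) i) : x = 0 := by
  refine localCohomology_map_f_injective isCofinal_powIdeal
    (interComplex_shortExact (varPowIdeal K F e) (varPowIdeal K G e)) (i := i)
    (fun j hj => ?_) ?_
  · change ∀ x : H (varPowIdeal K F e ⊔ varPowIdeal K G e) j, x = 0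
    rw [varPowIdeal_union]
    refine localCohomology_varPowIdeal_eq_zero he _ _ ?_
    rw [hFG, Finset.card_univ, Fintype.card_fin]
    omega
  · have h := localCohomology_prod_eq_zero isCofinal_powIdeal
      (localCohomology_varPowIdeal_eq_zero (K := K) he F i hF)
      (localCohomology_varPowIdeal_eq_zero (K := K) he G i hG)
    exact (h _).trans (h _).symm

lemma containsPow_varPowIdeal_sup (hFG : F ∪ G = Finset.univ) (e : Fin n → ℕ) :
    ContainsPow (maxIdeal K n) (varPowIdeal K F e ⊔ varPowIdeal K G e) := by
  rw [varPowIdeal_union, hFG]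
  exact containsPow_varPowIdeal_univ e

/-- The module is generated by `interClass`, hence a quotient of the finite-length ring `S ⧸ (b ⊔
c)`. -/
lemma isFiniteLength_H_one_varPowIdeal_inf (he : ∀ j, 1 ≤ e j) (hFG : F ∪ G = Finset.univ)
    (hF : 1 + F.card ≠ n) (hG : 1 + G.card ≠ n) :
    IsFiniteLength (MvPolynomial (Fin n) K) (H (varPowIdeal K F e ⊓ varPowIdeal K G e) 1) := by
  have hC := containsPow_varPowIdeal_sup (K := K) hFG e
  have hfin := isFiniteLength_quotient_varPowIdeal (K := K) e he
  rw [← hFG, ← varPowIdeal_union] at hfin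
  refine hfin.of_surjective (f := Submodule.liftQ _
    (LinearMap.toSpanSingleton _ _ (interClass hC)) ?_) ?_
  · intro r hr
    exact smul_interClass hC hr
  · intro x
    obtain ⟨r, rfl⟩ := exists_eq_smul_interClass isCofinal_powIdeal hC
      (localCohomology_prod_eq_zero isCofinal_powIdeal
        (localCohomology_varPowIdeal_eq_zero (K := K) he F 1 hF)
        (localCohomology_varPowIdeal_eq_zero (K := K) he G 1 hG)) x
    exact ⟨Submodule.Quotient.mk r, rfl⟩

lemma exists_mem_powIdeal_regular {j : Fin n} (hj : j ∉ F) (e : Fin n → ℕ) (s : ℕ) :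
    ∃ p ∈ powIdeal K Finset.univ s, ∀ f, p * f ∈ varPowIdeal K F e → f ∈ varPowIdeal K F e :=
  ⟨X j ^ s, X_pow_mem_varPowIdeal (Finset.mem_univ j) fun _ => s,
    varPowIdeal_pow_regular hj e s⟩

lemma mem_of_smul_interClass_varPowIdeal_eq_zero (hFG : F ∪ G = Finset.univ)
    {j l : Fin n} (hj : j ∉ F) (hl : l ∉ G) {r : MvPolynomial (Fin n) K}
    (hr : r • interClass (containsPow_varPowIdeal_sup (K := K) hFG e) = 0) :
    r ∈ varPowIdeal K Finset.univ e := by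
  rw [← hFG, ← varPowIdeal_union]
  exact mem_sup_of_smul_interClass_eq_zero isCofinal_powIdeal _
    (exists_mem_powIdeal_regular hj e) (exists_mem_powIdeal_regular hl e) hr

end TwoSubspaces

/-! ### The extremal example in four variables -/

section Sharpness

/-- The exponents `(k, 1, 1, 1)`. -/
def sharpExponent (k : ℕ) : Fin 4 → ℕ := ![k, 1, 1, 1]

/-- The ideal `(X_0 ^ k, X_1) ∩ (X_2, X_3)`. -/
def sharpIdeal (K : Type u) [Field K] (k : ℕ) : Ideal (MvPolynomial (Fin 4) K) :=
  varPowIdeal K {0, 1} (sharpExponent k) ⊓ varPowIdeal K {2, 3} (sharpExponent k)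

variable {K : Type u} [Field K] {k : ℕ} (hk : 1 ≤ k)

include hk

lemma one_le_sharpExponent (j : Fin 4) : 1 ≤ sharpExponent k j := by
  fin_cases j <;> simp [sharpExponent, hk]

lemma ringKrullDim_sharpIdeal : ringKrullDim (MvPolynomial (Fin 4) K ⧸ sharpIdeal K k) = 2 :=
  ringKrullDim_quotient_varPowIdeal_inf (one_le_sharpExponent hk) (by decide)

lemma isGeneralizedCM_sharpIdeal : IsGeneralizedCM (sharpIdeal K k) := by
  intro i hi
  rw [ringKrullDim_sharpIdeal hk] at hi
  have hi2 : i ≠ 2 := by rintro rfl; exact hi rfl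
  by_cases h1 : i = 1
  · subst h1
    exact isFiniteLength_H_one_varPowIdeal_inf (one_le_sharpExponent hk) (by decide) (by decide)
      (by decide)
  · have hc1 : ({0, 1} : Finset (Fin 4)).card = 2 := by decide
    have hc2 : ({2, 3} : Finset (Fin 4)).card = 2 := by decide
    have := localCohomology_varPowIdeal_inf_eq_zero (K := K) (one_le_sharpExponent hk)
      (F := {0, 1}) (G := {2, 3}) (by decide) h1 (by omega) (by omega)
    have : Subsingleton (H (sharpIdeal K k) i) := ⟨fun x y => (this x).trans (this y).symm⟩
    exact IsFiniteLength.of_subsingleton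

lemma sum_rho_sharpIdeal : ∑ j, (rho (sharpIdeal K k) j : ℤ) = k + 3 := by
  have hF : ∀ j ∈ ({0, 1} : Finset (Fin 4)), rho (sharpIdeal K k) j = sharpExponent k j :=
    fun j hj => rho_varPowIdeal_inf (by decide) (by decide) (one_le_sharpExponent hk) hj
  have hG : ∀ j ∈ ({2, 3} : Finset (Fin 4)), rho (sharpIdeal K k) j = sharpExponent k j := by
    intro j hj
    rw [sharpIdeal, inf_comm]
    exact rho_varPowIdeal_inf (by decide) (by decide) (one_le_sharpExponent hk) hj
  rw [Fin.sum_univ_four, hF 0 (by decide), hF 1 (by decide), hG 2 (by decide), hG 3 (by decide)]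
  simp [sharpExponent]
  ring

lemma not_isBuchsbaum_sharpIdeal : ¬ IsBuchsbaum ((k : ℤ) - 1) (sharpIdeal K k) := by
  intro h
  have h1 := h 1 (by rw [ringKrullDim_sharpIdeal hk]; decide)
  have hmem : (X 0 : MvPolynomial (Fin 4) K) ^ (k - 1) ∈ maxIdeal K 4 ^ ((k : ℤ) - 1).toNat := by
    have : ((k : ℤ) - 1).toNat = k - 1 := by omega
    rw [this]
    exact Ideal.pow_mem_pow (X_mem_maxIdeal 0) _
  have hFG : ({0, 1} ∪ {2, 3} : Finset (Fin 4)) = Finset.univ := by decide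
  let D : H (sharpIdeal K k) 1 :=
    interClass (containsPow_varPowIdeal_sup (K := K) hFG (sharpExponent k))
  have hD : (X 0 : MvPolynomial (Fin 4) K) ^ (k - 1) • D = 0 := by
    rw [← Submodule.mem_bot (MvPolynomial (Fin 4) K), ← h1]
    exact Submodule.smul_mem_smul hmem trivial
  have := mem_of_smul_interClass_varPowIdeal_eq_zero hFG (j := 2) (l := 0) (by decide) (by decide)
    hD
  -- Membership of $X_0^{k-1}$ in $(X_0^k, X_1, X_2, X_3)$ would force $k \le k-1$, impossible as $k
  -- \ge 1$.
  rw [X_pow_eq_monomial, monomial_mem_varPowIdeal] at this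
  obtain ⟨l, -, hl⟩ := this
  fin_cases l <;> simp [sharpExponent] at hl
  omega

lemma isStrictlyBuchsbaum_sharpIdeal : IsStrictlyBuchsbaum k (sharpIdeal K k) := by
  refine ⟨?_, not_isBuchsbaum_sharpIdeal hk⟩
  have h : (∑ j, (rho (sharpIdeal K k) j : ℤ)) - (4 : ℕ) + 1 = k := by
    rw [sum_rho_sharpIdeal hk]
    push_cast
    ring
  have hI : IsMonomialIdeal (sharpIdeal K k) := isMonomialIdeal_varPowIdeal_inf _ _ _
  exact h ▸ hI.isBuchsbaum (isGeneralizedCM_sharpIdeal hk)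

end Sharpness

end
end MonomialLC

theorem mainTheorem2 (K : Type*) [Field K] :
    (∀ (n : ℕ) (I : Ideal (MvPolynomial (Fin n) K)),
      MonomialLC.IsMonomialIdeal I → MonomialLC.IsGeneralizedCM I →
        MonomialLC.IsBuchsbaum ((∑ j, (MonomialLC.rho I j : ℤ)) - n + 1) I) ∧
    (∀ k : ℤ, 1 ≤ k → ∃ (n : ℕ) (I : Ideal (MvPolynomial (Fin n) K)),
      MonomialLC.IsMonomialIdeal I ∧ MonomialLC.IsGeneralizedCM I ∧
        (∑ j, (MonomialLC.rho I j : ℤ)) - n + 1 = k ∧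
        MonomialLC.IsStrictlyBuchsbaum k I) := by
  refine ⟨fun n I hI hgcm => hI.isBuchsbaum hgcm, fun k hk => ?_⟩
  obtain ⟨k, rfl⟩ := Int.eq_ofNat_of_zero_le (by omega : 0 ≤ k)
  have hk' : 1 ≤ k := by omega
  refine ⟨4, MonomialLC.sharpIdeal K k, MonomialLC.isMonomialIdeal_varPowIdeal_inf _ _ _,
    MonomialLC.isGeneralizedCM_sharpIdeal hk', ?_, MonomialLC.isStrictlyBuchsbaum_sharpIdeal hk'⟩
  rw [MonomialLC.sum_rho_sharpIdeal hk']
  push_cast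
  ring
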